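/- **Conventions.** $(a)_n=a(a+1)\cdots(a+n-1)$; $\Gamma(\mathbf{a_p})=\prod_{i=1}^p\Gamma(a_i)$, $\Gamma(\mathbf{b_q})=\prod_{j=1}^q\Gamma(b_j)$; $1/\Gamma$ is the entire reciprocal Gamma function; complex powers of positive numbers are principal. The generalized $M$-series, the $K$-function and the Fox–Wright function are $${}_pM_q^{\xi,\eta}(w)=\sum_{n\ge0}\frac{(a_1)_n\cdots(a_p)_n}{(b_1)_n\cdots(b_q)_n}\frac{w^n}{\Gamma(\xi n+\eta)},\qquad {}_pK_q^{\xi,\eta;\nu}(w)=\sum_{n\ge0}\frac{(a_1)_n\cdots(a_p)_n}{(b_1)_n\cdots(b_q)_n}\frac{(\nu)_n}{\Gamma(\xi n+\eta)}\frac{w^n}{n!},$$ $${}_p\psi_q\!\left(\begin{matrix}(A_i,\alpha_i)_1^p\\(B_j,\beta_j)_1^q\end{matrix};w\right)=\sum_{n\ge0}\frac{\prod_{i=1}^p\Gamma(A_i+\alpha_in)}{\prod_{j=1}^q\Gamma(B_j+\beta_jn)}\frac{w^n}{n!}.$$ Appell's function is $$F_3(\alpha,\alpha',\beta,\beta',\gamma;x,y)=\sum_{m,n\ge0}\frac{(\alpha)_m(\alpha')_n(\beta)_m(\beta')_n}{(\gamma)_{m+n}}\frac{x^m}{m!}\frac{y^n}{n!}\qquad(|x|,|y|<1),$$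 continued holomorphically along star-shaped domains about the origin (principal branch). For $\Re(\gamma)>0$ and $x>0$, Saigo–Maeda's right-sided fractional integral is $$\bigl(\mathcal I_{x-}^{\alpha,\alpha',\beta,\beta',\gamma}f\bigr)(x)=\frac{x^{-\alpha'}}{\Gamma(\gamma)}\int_x^\infty(t-x)^{\gamma-1}t^{-\alpha}F_3\!\left(\alpha,\alpha',\beta,\beta',\gamma;1-\tfrac xt,1-\tfrac tx\right)f(t)\,dt .$$ **Theorem.** Let $\alpha,\alpha',\beta,\beta',\gamma,\eta,\nu,\xi,\sigma\in\mathbb C$ with $\Re(\nu)>0$, $\Re(\xi)>0$, $\Re(\gamma)>0$, let $\mu>0$, $c\in\mathbb R$, and let $a_1,\dots,a_p,b_1,\dots,b_q\in\mathbb C$. Then for every $z>0$ $$\mathcal I_{z-}^{\alpha,\alpha',\beta,\beta',\gamma}\Bigl(t^{\sigma-1}{}_pM_q^{\xi,\eta}(ct^{-\mu})\Bigr)(z)=\frac{\Gamma(\mathbf{b_q})}{\Gamma(\mathbf{a_p})}\,z^{\sigma-\alpha-\alpha'+\gamma-1}$$ $$\times\;{}_{p+4}\psi_{q+4}\!\left(\begin{matrix}(a_i,1)_1^p,\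 (1+\alpha+\alpha'-\gamma-\sigma,\mu),\ (1+\alpha+\beta'-\gamma-\sigma,\mu),\ (1-\beta-\sigma,\mu),\ (1,1)\\(b_j,1)_1^q,\ (1-\sigma,\mu),\ (1+\alpha+\alpha'+\beta'-\gamma-\sigma,\mu),\ (1+\alpha-\beta-\sigma,\mu),\ (\eta,\xi)\end{matrix};cz^{-\mu}\right),$$ provided that each member exists, and $$\mathcal I_{z-}^{\alpha,\alpha',\beta,\beta',\gamma}\Bigl(t^{\sigma-1}{}_pK_q^{\xi,\eta;\nu}(ct^{-\mu})\Bigr)(z)=\frac{\Gamma(\mathbf{b_q})}{\Gamma(\mathbf{a_p})}\,\frac{z^{\sigma-\alpha-\alpha'+\gamma-1}}{\Gamma(\nu)}$$ $$\times\;{}_{p+4}\psi_{q+4}\!\left(\begin{matrix}(a_i,1)_1^p,\ (1+\alpha+\alpha'-\gamma-\sigma,\mu),\ (1+\alpha+\beta'-\gamma-\sigma,\mu),\ (1-\beta-\sigma,\mu),\ (\nu,1)\\(b_j,1)_1^q,\ (1-\sigma,\mu),\ (1+\alpha+\alpha'+\beta'-\gamma-\sigma,\mu),\ (1+\alpha-\beta-\sigma,\mu),\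 (\eta,\xi)\end{matrix};cz^{-\mu}\right),$$ provided that each member exists. Here the left member exists if no $b_j$ is a non-positive integer, the series of ${}_pM_q$ (resp. ${}_pK_q$) converges absolutely at $ct^{-\mu}$ for all $t>z$, and the integrand is Lebesgue integrable on $(z,\infty)$; the right member exists if no Gamma factor in a numerator of the $\psi$-series is taken at a pole and that series converges absolutely. -/

import Mathlib

open Filter Topology MeasureTheory Set

noncomputable section

/-- The Pochhammer symbol `(a)_n = a (a+1) ⋯ (a+n-1)`. -/
def poch (a : ℂ) (n : ℕ) : ℂ := (ascPochhammer ℂ n).eval a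

/-- `Γ(v_1) ⋯ Γ(v_p)`. -/
def gammaProd {p : ℕ} (v : Fin p → ℂ) : ℂ := ∏ i, Complex.Gamma (v i)

/-! ### The generalized M-series and the K-function

`1 / Γ(ξ n + η)` is the entire reciprocal Gamma function: it vanishes at the poles of `Γ`. In Lean
this is automatic, because `Complex.Gamma` is `0` at its poles and `1 / 0 = 0`. -/

/-- The `n`-th term of the generalized M-series. -/
def mSeriesTerm {p q : ℕ} (a : Fin p → ℂ) (b : Fin q → ℂ) (ξ η z : ℂ) (n : ℕ) : ℂ :=
  (∏ i, poch (a i) n) / (∏ j, poch (b j) n) * (z ^ n / Complex.Gamma (ξ * n + η))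

/-- The generalized M-series `pM_q^{ξ,η}(z)`. -/
def mSeries {p q : ℕ} (a : Fin p → ℂ) (b : Fin q → ℂ) (ξ η z : ℂ) : ℂ :=
  ∑' n : ℕ, mSeriesTerm a b ξ η z n

/-- The M-series exists at `z`: no `b j` is a non-positive integer, and the series converges. -/
def MSeriesExists {p q : ℕ} (a : Fin p → ℂ) (b : Fin q → ℂ) (ξ η z : ℂ) : Prop :=
  (∀ (j : Fin q) (k : ℕ), b j ≠ -(k : ℂ)) ∧ Summable (mSeriesTerm a b ξ η z)

/-- The `n`-th term of the K-function. -/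
def kFunctionTerm {p q : ℕ} (a : Fin p → ℂ) (b : Fin q → ℂ) (ξ η ν z : ℂ) (n : ℕ) : ℂ :=
  (∏ i, poch (a i) n) / (∏ j, poch (b j) n) *
    (poch ν n / Complex.Gamma (ξ * n + η)) * (z ^ n / (n.factorial : ℂ))

/-- The K-function `pK_q^{ξ,η;ν}(z)`. -/
def kFunction {p q : ℕ} (a : Fin p → ℂ) (b : Fin q → ℂ) (ξ η ν z : ℂ) : ℂ :=
  ∑' n : ℕ, kFunctionTerm a b ξ η ν z n

/-- The K-function exists at `z`: no `b j` is a non-positive integer, and the series converges. -/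
def KFunctionExists {p q : ℕ} (a : Fin p → ℂ) (b : Fin q → ℂ) (ξ η ν z : ℂ) : Prop :=
  (∀ (j : Fin q) (k : ℕ), b j ≠ -(k : ℂ)) ∧ Summable (kFunctionTerm a b ξ η ν z)

/-! ### The Fox–Wright psi function -/

/-- The `n`-th term of the Fox–Wright psi series; a parameter `(a, α)` is stored as a pair. -/
def foxWrightTerm {p q : ℕ} (A : Fin p → ℂ × ℂ) (B : Fin q → ℂ × ℂ) (z : ℂ) (n : ℕ) : ℂ :=
  (∏ i, Complex.Gamma ((A i).1 + (A i).2 * n)) / (∏ j, Complex.Gamma ((B j).1 + (B j).2 * n)) *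
    (z ^ n / (n.factorial : ℂ))

/-- The Fox–Wright psi function `pψ_q(z)`. -/
def foxWright {p q : ℕ} (A : Fin p → ℂ × ℂ) (B : Fin q → ℂ × ℂ) (z : ℂ) : ℂ :=
  ∑' n : ℕ, foxWrightTerm A B z n

/-- The psi function exists at `z`: no Gamma factor in a numerator is taken at a pole of `Γ`,
and the series converges. -/
def FoxWrightExists {p q : ℕ} (A : Fin p → ℂ × ℂ) (B : Fin q → ℂ × ℂ) (z : ℂ) : Prop :=
  (∀ (i : Fin p) (n k : ℕ), (A i).1 + (A i).2 * n ≠ -(k : ℂ)) ∧ Summable (foxWrightTerm A B z)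

/-! ### Appell's function `F₃` -/

/-- Appell's double series
`∑ (α)_m (α')_n (β)_m (β')_n / (γ)_{m+n} · x^m / m! · y^n / n!`, for `|x| < 1`, `|y| < 1`. -/
def appellF3Series (α α' β β' γ x y : ℂ) : ℂ :=
  ∑' k : ℕ × ℕ, poch α k.1 * poch α' k.2 * poch β k.1 * poch β' k.2 / poch γ (k.1 + k.2) *
    (x ^ k.1 / (k.1.factorial : ℂ)) * (y ^ k.2 / (k.2.factorial : ℂ))

/-- `w` is the value at `(x, y)` of a holomorphic continuation of Appell's series: there are an open
set `U` of `ℂ × ℂ`, star-shaped about the origin and containing `(x, y)`, and a holomorphic function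
`G` on `U` that agrees with the series near the origin and takes the value `w` at `(x, y)`. -/
def IsAppellF3Value (α α' β β' γ x y w : ℂ) : Prop :=
  ∃ (U : Set (ℂ × ℂ)) (G : ℂ × ℂ → ℂ), IsOpen U ∧ StarConvex ℝ 0 U ∧ (x, y) ∈ U ∧
    DifferentiableOn ℂ G U ∧
    (∀ᶠ v in 𝓝 (0 : ℂ × ℂ), G v = appellF3Series α α' β β' γ v.1 v.2) ∧ G (x, y) = w

/-- The value of a continuation does not depend on the choice of `U` and `G`. -/
theorem IsAppellF3Value.unique {α α' β β' γ x y w w' : ℂ}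
    (h : IsAppellF3Value α α' β β' γ x y w) (h' : IsAppellF3Value α α' β β' γ x y w') :
    w = w' := by
  obtain ⟨U, G, hUo, hUs, hxU, hG, hGs, rfl⟩ := h
  obtain ⟨U', G', hUo', hUs', hxU', hG', hGs', rfl⟩ := h'
  let L : ℂ → ℂ × ℂ := fun s => (s * x, s * y)
  have hL : Differentiable ℂ L := by
    intro s; simp only [L]; fun_prop
  have hL0 : L 0 = 0 := by simp [L]
  let V : Set ℂ := L ⁻¹' (U ∩ U')
  have hVo : IsOpen V := (hUo.inter hUo').preimage hL.continuous
  have h1V : (1 : ℂ) ∈ V := by simp [V, L, hxU, hxU']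
  have hVs : StarConvex ℝ 0 V := by
    have hI : StarConvex ℝ (0 : ℂ × ℂ) (U ∩ U') := hUs.inter hUs'
    intro s hs r t hr ht hrt
    have := hI hs hr ht hrt
    simp only [V, mem_preimage] at hs ⊢
    convert this using 1
    simp [L, mul_assoc]
  have h0V : (0 : ℂ) ∈ V := by
    have := hVs h1V (zero_le_one) le_rfl (by norm_num : (1 : ℝ) + 0 = 1)
    simpa using this
  have hVc : IsPreconnected V := (StarConvex.isPathConnected hVs h0V).isConnected.isPreconnected
  have hf : AnalyticOnNhd ℂ (G ∘ L) V :=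
    (hG.comp hL.differentiableOn (fun s hs => hs.1)).analyticOnNhd hVo
  have hf' : AnalyticOnNhd ℂ (G' ∘ L) V :=
    (hG'.comp hL.differentiableOn (fun s hs => hs.2)).analyticOnNhd hVo
  have ht : Tendsto L (𝓝 0) (𝓝 0) := by
    have := hL.continuous.tendsto 0
    rwa [hL0] at this
  have he : (G ∘ L) =ᶠ[𝓝 0] (G' ∘ L) := by
    filter_upwards [ht.eventually hGs, ht.eventually hGs'] with s hs hs'
    simp only [Function.comp, hs, hs']
  have := hf.eqOn_of_preconnected_of_eventuallyEq hf' hVc h0V he h1V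
  simpa [L] using this

open Classical in
/-- Appell's function `F₃`, as the holomorphic continuation of Appell's series along star-shaped
domains (the principal branch), with the value `0` where there is no such continuation. -/
def appellF3 (α α' β β' γ x y : ℂ) : ℂ :=
  if h : ∃ w, IsAppellF3Value α α' β β' γ x y w then h.choose else 0

theorem IsAppellF3Value.appellF3_eq {α α' β β' γ x y w : ℂ}
    (h : IsAppellF3Value α α' β β' γ x y w) : appellF3 α α' β β' γ x y = w := by
  have hex : ∃ w, IsAppellF3Value α α' β β' γ x y w := ⟨w, h⟩
  rw [appellF3, dif_pos hex]
  exact hex.choose_spec.unique h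

/-! ### The right-sided Saigo–Maeda fractional integral -/

/-- The integrand of the right-sided Saigo–Maeda fractional integral of `f` at `x`. -/
def saigoMaedaRightIntegrand (α α' β β' γ : ℂ) (f : ℝ → ℂ) (x t : ℝ) : ℂ :=
  ((t - x : ℝ) : ℂ) ^ (γ - 1) * (t : ℂ) ^ (-α) *
    appellF3 α α' β β' γ ((1 - x / t : ℝ) : ℂ) ((1 - t / x : ℝ) : ℂ) * f t

/-- The right-sided Saigo–Maeda fractional integral of `f` at `x > 0`. -/
def saigoMaedaRight (α α' β β' γ : ℂ) (f : ℝ → ℂ) (x : ℝ) : ℂ :=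
  (x : ℂ) ^ (-α') / Complex.Gamma γ *
    ∫ t in Ioi x, saigoMaedaRightIntegrand α α' β β' γ f x t

/-- The right-sided Saigo–Maeda fractional integral of `f` exists at `x`. -/
def SaigoMaedaRightExists (α α' β β' γ : ℂ) (f : ℝ → ℂ) (x : ℝ) : Prop :=
  IntegrableOn (saigoMaedaRightIntegrand α α' β β' γ f x) (Ioi x)

end

noncomputable section

/-! ### Pochhammer symbols -/

/-! Under `t = z e^u` the fractional integral becomes a constant times the Laplace-type integral of
`e^{-s₀u} k(u) ∑ T_n e^{-μnu}` over `u > 0`. Here `s₀ = 1 + α - γ - σ`, `T_n` is the `n`-th term of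
the series at `t = z`, and `k(u) = (1 - e^{-u})^{γ-1} F₃(1 - e^{-u}, 1 - e^u)`. Two things are
needed: the Laplace transform of `k`, and the right to integrate termwise.

Laplace transform. Splitting `γ = c₁ + c₂` writes `F₃` as an Euler integral of a product of two
Gauss functions (`f3Cont`). Pfaff's transformation in the second factor makes this both the
holomorphic continuation of Appell's series to `Re y < 1/2` and, in exponential coordinates, a
convolution (`f3Kernel_eq_convolution`). The transform is thus a product of two transforms of Gauss
kernels. Each is a Gamma quotient by termwise beta integrals and Gauss's summation theorem
(`exists_laplace_gaussSeries`), so that far to the right the transform is `f3Symbol`. Multiplying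
through by reciprocal Gamma functions makes the other side entire, and the identity propagates to
every point of absolute convergence, boundary line included (`laplace_mul_eq_of_eventually`).

Termwise integration. Only existence of both members is assumed. Integrability of the whole
integrand forces integrability against the first exponential with a non-zero coefficient
(`integrableOn_exp_mul_of_integrableOn_mul_tsum`). Since `k(u)` behaves like `u^{γ-1}` at `0`, for
large `n` the integral of `|e^{-μnu} e^{-s₀u} k(u)|` is at most a constant times the modulus of the
integral without absolute values (`exists_integral_norm_le_mul_norm_laplace`). Absolute convergence
of the Fox–Wright series therefore gives the absolute convergence that Fubini requires.

The M-series is the K-function with `ν = 1`. -/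

@[simp] theorem poch_zero (a : ℂ) : poch a 0 = 1 := by simp [poch]

theorem poch_succ (a : ℂ) (n : ℕ) : poch a (n + 1) = poch a n * (a + n) := by
  simp [poch, ascPochhammer_succ_right]

theorem poch_succ_left (a : ℂ) (n : ℕ) : poch a (n + 1) = a * poch (a + 1) n := by
  simp [poch, ascPochhammer_succ_left]

theorem poch_add (a : ℂ) (m n : ℕ) : poch a (m + n) = poch a m * poch (a + m) n := by
  induction n with
  | zero => simp
  | succ n ih => rw [← add_assoc, poch_succ, ih, poch_succ]; push_cast; ring

theorem ne_neg_natCast_of_re_pos {a : ℂ} (ha : 0 < a.re) (k : ℕ) : a ≠ -(k : ℂ) := by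
  rintro rfl
  simp only [Complex.neg_re, Complex.natCast_re] at ha
  have : (0 : ℝ) ≤ k := k.cast_nonneg
  linarith

theorem poch_mul_Gamma {a : ℂ} (ha : ∀ k : ℕ, a ≠ -(k : ℂ)) (n : ℕ) :
    poch a n * Complex.Gamma a = Complex.Gamma (a + n) := by
  rw [poch, ← Complex.Gamma_add_nat_div_Gamma_eq a ha,
    div_mul_cancel₀ _ (Complex.Gamma_ne_zero ha)]

theorem poch_ne_zero {a : ℂ} (ha : ∀ k : ℕ, a ≠ -(k : ℂ)) (n : ℕ) : poch a n ≠ 0 := by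
  induction n with
  | zero => simp
  | succ n ih =>
    rw [poch_succ]
    exact mul_ne_zero ih fun h => ha n (eq_neg_of_add_eq_zero_left h)

/-- Factor by factor, `|(a)_n|` is at most `(A+1)_n = n! (n+A choose A)`. The binomial form is
chosen because its generating function is a power of `1/(1 - r)`. -/
theorem norm_poch_le {a : ℂ} {A : ℕ} (hA : ‖a‖ ≤ A + 1) (n : ℕ) :
    ‖poch a n‖ ≤ n.factorial * (n + A).choose A := by
  induction n with
  | zero => simp
  | succ n ih =>
    have h1 : ((n + 1 : ℕ).factorial : ℝ) * ((n + 1 + A).choose A : ℝ)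
        = (n.factorial * (n + A).choose A) * (A + 1 + n) := by
      have h : (n + 1 + A).choose A * (n + 1) = (n + A).choose A * (n + 1 + A) := by
        have := Nat.add_one_mul_choose_eq (n + A) n
        rw [Nat.choose_symm_of_eq_add (show n + 1 + A = A + (n + 1) by ring),
          Nat.choose_symm_of_eq_add (show n + A = A + n by ring)]
        rw [show n + 1 + A = n + A + 1 by ring]
        linarith
      have h' : ((n + 1 + A).choose A : ℝ) * (n + 1) = (n + A).choose A * (n + 1 + A) := by
        exact_mod_cast h
      rw [Nat.factorial_succ]; push_cast
      linear_combination (n.factorial : ℝ) * h'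
    rw [poch_succ, norm_mul, h1]
    gcongr
    calc ‖a + n‖ ≤ ‖a‖ + ‖(n : ℂ)‖ := norm_add_le _ _
      _ ≤ A + 1 + n := by simpa using hA

/-! ### Gauss's hypergeometric series -/

/-- The coefficient `(a)_m (b)_m / ((c)_m m!)` of Gauss's hypergeometric series. -/
def gaussCoeff (a b c : ℂ) (m : ℕ) : ℂ := poch a m * poch b m / (poch c m * m.factorial)

/-- Gauss's hypergeometric series `₂F₁(a, b; c; x)`. -/
def gaussSeries (a b c x : ℂ) : ℂ := ∑' m : ℕ, gaussCoeff a b c m * x ^ m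

@[simp] theorem gaussCoeff_zero (a b c : ℂ) : gaussCoeff a b c 0 = 1 := by simp [gaussCoeff]

theorem gaussCoeff_succ (a b c : ℂ) (m : ℕ) :
    gaussCoeff a b c (m + 1) = gaussCoeff a b c m * ((a + m) * (b + m) / ((c + m) * (m + 1))) := by
  simp only [gaussCoeff, poch_succ, Nat.factorial_succ]
  push_cast
  rw [div_mul_div_comm]
  congr 1 <;> ring

/-- The coefficients grow at most polynomially: for `M ≥ 1` the ratio of consecutive ones is at most
`(M+1+K)/(M+1)`, the ratio of the binomials, because `|c + M| ≥ M`. -/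
theorem exists_gaussCoeff_bound (a b : ℂ) {c : ℂ} (hc : 0 < c.re) :
    ∃ (C : ℝ) (K : ℕ), 0 < C ∧ ∀ m, ‖gaussCoeff a b c m‖ ≤ C * (m + K).choose K := by
  obtain ⟨K, hK⟩ := exists_nat_ge (‖a‖ + ‖b‖ + ‖a‖ * ‖b‖)
  set C : ℝ := max 1 ‖gaussCoeff a b c 1‖
  have hC1 : 1 ≤ C := le_max_left _ _
  refine ⟨C, K, by positivity, fun m => ?_⟩
  have hch : ∀ m : ℕ, (1 : ℝ) ≤ (m + K).choose K := fun m => by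
    exact_mod_cast Nat.choose_pos (Nat.le_add_left _ _)
  -- The ratio bound fails from index `0` to `1`, where `|c|` may be small; `C` absorbs the
  -- coefficient of index `1` and the induction starts there.
  rcases m with _ | m
  · simpa using hC1
  induction m with
  | zero => exact (le_max_right _ _).trans (le_mul_of_one_le_right (by positivity) (hch 1))
  | succ m ih =>
    set M : ℕ := m + 1 with hM
    have hM1 : (1 : ℝ) ≤ M := by rw [hM]; push_cast; linarith [(m.cast_nonneg : (0 : ℝ) ≤ m)]
    have hcM : (M : ℝ) ≤ ‖c + M‖ := by
      refine le_trans ?_ (Complex.re_le_norm _)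
      simp; linarith
    have hnum : ‖(a + M) * (b + M)‖ ≤ M * (M + 1 + K) := by
      have h1 : ‖a + M‖ ≤ ‖a‖ + M := (norm_add_le _ _).trans (by simp)
      have h2 : ‖b + M‖ ≤ ‖b‖ + M := (norm_add_le _ _).trans (by simp)
      rw [norm_mul]
      calc ‖a + M‖ * ‖b + M‖ ≤ (‖a‖ + M) * (‖b‖ + M) := by gcongr
        _ ≤ M * (M + 1 + K) := by
          have hab : 0 ≤ ‖a‖ * ‖b‖ := by positivity
          have hM2 : (M : ℝ) * (‖a‖ + ‖b‖ + ‖a‖ * ‖b‖) ≤ M * K := by gcongr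
          have hM3 : 1 * (‖a‖ * ‖b‖) ≤ M * (‖a‖ * ‖b‖) := by gcongr
          nlinarith
    have h' : ((M + 1 + K).choose K : ℝ) = (M + K).choose K * ((M + 1 + K) / (M + 1)) := by
      have h : (M + 1 + K).choose K * (M + 1) = (M + K).choose K * (M + 1 + K) := by
        have := Nat.add_one_mul_choose_eq (M + K) M
        rw [Nat.choose_symm_of_eq_add (show M + 1 + K = K + (M + 1) by ring),
          Nat.choose_symm_of_eq_add (show M + K = K + M by ring)]
        rw [show M + 1 + K = M + K + 1 by ring]
        linarith
      have h'' : ((M + 1 + K).choose K : ℝ) * (M + 1) = (M + K).choose K * (M + 1 + K) := by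
        exact_mod_cast h
      field_simp
      linarith
    rw [gaussCoeff_succ, norm_mul, h', ← mul_assoc]
    gcongr
    rw [norm_div, norm_mul (c + M)]
    have h1 : ‖(M : ℂ) + 1‖ = M + 1 := by
      have : (M : ℂ) + 1 = ((M + 1 : ℕ) : ℂ) := by push_cast; ring
      rw [this, Complex.norm_natCast]; push_cast; ring
    rw [h1, div_le_div_iff₀ (mul_pos (by linarith) (by positivity)) (by positivity)]
    calc ‖(a + M) * (b + M)‖ * (M + 1) ≤ (M * (M + 1 + K)) * (M + 1) := by gcongr
      _ ≤ (‖c + M‖ * (M + 1 + K)) * (M + 1) := by gcongr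
      _ = _ := by ring

theorem summable_choose_mul_pow (K : ℕ) {r : ℝ} (h0 : 0 ≤ r) (h1 : r < 1) :
    HasSum (fun m : ℕ => ((m + K).choose K : ℝ) * r ^ m) (1 / (1 - r) ^ (K + 1)) :=
  hasSum_choose_mul_geometric_of_norm_lt_one K (by rwa [Real.norm_of_nonneg h0])

theorem summable_norm_gaussSeries (a b : ℂ) {c x : ℂ} (hc : 0 < c.re) (hx : ‖x‖ < 1) :
    Summable fun m => ‖gaussCoeff a b c m * x ^ m‖ := by
  obtain ⟨C, K, -, h⟩ := exists_gaussCoeff_bound a b hc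
  refine .of_nonneg_of_le (fun _ => norm_nonneg _) (fun m => ?_)
    ((summable_choose_mul_pow K (norm_nonneg x) hx).summable.mul_left C)
  rw [norm_mul, norm_pow, ← mul_assoc]
  gcongr
  exact h m

theorem hasSum_gaussSeries (a b : ℂ) {c x : ℂ} (hc : 0 < c.re) (hx : ‖x‖ < 1) :
    HasSum (fun m => gaussCoeff a b c m * x ^ m) (gaussSeries a b c x) :=
  (summable_norm_gaussSeries a b hc hx).of_norm.hasSum

@[simp] theorem gaussSeries_zero (a b c : ℂ) : gaussSeries a b c 0 = 1 := by
  rw [gaussSeries, tsum_eq_single 0 (fun m hm => by simp [hm])]; simp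

theorem differentiableOn_gaussSeries (a b : ℂ) {c : ℂ} (hc : 0 < c.re) :
    DifferentiableOn ℂ (gaussSeries a b c) (Metric.ball 0 1) := by
  obtain ⟨C, K, hC, h⟩ := exists_gaussCoeff_bound a b hc
  intro x hx
  rw [mem_ball_zero_iff] at hx
  obtain ⟨r, hxr, hr⟩ := exists_between hx
  have hr0 : 0 ≤ r := (norm_nonneg x).trans hxr.le
  have hd : DifferentiableOn ℂ (gaussSeries a b c) (Metric.ball 0 r) := by
    refine Complex.differentiableOn_tsum_of_summable_norm
      ((summable_choose_mul_pow K hr0 hr).summable.mul_left C) (fun m => by fun_prop)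
      Metric.isOpen_ball (fun m w hw => ?_)
    rw [mem_ball_zero_iff] at hw
    rw [norm_mul, norm_pow, ← mul_assoc]
    gcongr
    exact h m
  exact ((hd.differentiableAt (Metric.isOpen_ball.mem_nhds (by simpa using hxr)))).differentiableWithinAt

/-- The Chu–Vandermonde identity. -/
theorem sum_choose_poch_div_poch (N : ℕ) (b : ℂ) {c : ℂ} (hc : 0 < c.re) :
    ∑ m ∈ Finset.range (N + 1), (N.choose m : ℂ) * ((-1) ^ m * poch (c - b) m / poch c m)
      = poch b N / poch c N := by
  induction N generalizing c with
  | zero => simp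
  | succ N ih =>
    have hc1 : 0 < (c + 1).re := by simp; linarith
    have hcn := ne_neg_natCast_of_re_pos hc
    have hc0 : c ≠ 0 := by simpa using hcn 0
    have hcN : c + N ≠ 0 := fun h => hcn N (eq_neg_of_add_eq_zero_left h)
    -- Pascal's rule splits the sum into the same sum for `N` and one with `c` replaced by `c + 1`;
    -- this is why the induction generalizes `c`.
    have key : ∑ m ∈ Finset.range (N + 1 + 1),
          ((N + 1).choose m : ℂ) * ((-1) ^ m * poch (c - b) m / poch c m)
        = ∑ m ∈ Finset.range (N + 1), (N.choose m : ℂ) * ((-1) ^ m * poch (c - b) m / poch c m)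
          - (c - b) / c * ∑ m ∈ Finset.range (N + 1),
            (N.choose m : ℂ) * ((-1) ^ m * poch (c + 1 - b) m / poch (c + 1) m) := by
      rw [Finset.sum_range_succ']
      have h1 : ∀ m ∈ Finset.range (N + 1), ((N + 1).choose (m + 1) : ℂ) *
          ((-1) ^ (m + 1) * poch (c - b) (m + 1) / poch c (m + 1))
          = (N.choose (m + 1) : ℂ) * ((-1) ^ (m + 1) * poch (c - b) (m + 1) / poch c (m + 1))
          - (c - b) / c * ((N.choose m : ℂ) * ((-1) ^ m * poch (c + 1 - b) m / poch (c + 1) m)) := by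
        intro m _
        rw [Nat.choose_succ_succ, poch_succ_left, poch_succ_left c,
          show c - b + 1 = c + 1 - b by ring]
        push_cast
        have := poch_ne_zero (ne_neg_natCast_of_re_pos hc1) m
        field_simp
        ring
      rw [Finset.sum_congr rfl h1, Finset.sum_sub_distrib, ← Finset.mul_sum]
      have h2 := Finset.sum_range_succ'
        (fun m => (N.choose m : ℂ) * ((-1) ^ m * poch (c - b) m / poch c m)) (N + 1)
      rw [Finset.sum_range_succ] at h2
      simp only [Nat.choose_succ_self, Nat.cast_zero, zero_mul, add_zero] at h2
      rw [h2]
      simp only [Nat.choose_zero_right]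
      ring
    rw [key, ih hc, ih hc1]
    have e1 : poch c N * (c + N) = c * poch (c + 1) N := by rw [← poch_succ, poch_succ_left]
    have := poch_ne_zero (ne_neg_natCast_of_re_pos hc1) N
    have := poch_ne_zero hcn N
    rw [poch_succ, poch_succ]
    have e2 : poch (c + 1) N = poch c N * (c + N) / c := by field_simp; linear_combination -e1
    rw [e2]
    field_simp
    ring

/-! ### Binomial series and Pfaff's transformation. -/

theorem poch_div_factorial_eq_choose (a : ℂ) (n : ℕ) :
    poch a n / n.factorial = Ring.choose (a + n - 1) n := by
  rw [Ring.choose_eq_smul, Polynomial.descPochhammer_smeval_eq_ascPochhammer,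
    Polynomial.ascPochhammer_smeval_cast, Polynomial.ascPochhammer_smeval_eq_eval, poch,
    show a + n - 1 - n + 1 = a by ring, smul_eq_mul, div_eq_inv_mul]

theorem hasSum_one_sub_cpow_neg (a : ℂ) {y : ℂ} (hy : ‖y‖ < 1) :
    HasSum (fun n : ℕ => poch a n / n.factorial * y ^ n) ((1 - y) ^ (-a)) := by
  have h := (Complex.one_div_one_sub_cpow_hasFPowerSeriesOnBall_zero a).hasSum (y := y)
    (by simpa [enorm_eq_nnnorm, ← NNReal.coe_lt_coe] using hy)
  simp only [FormalMultilinearSeries.ofScalars_apply_eq, zero_add, smul_eq_mul,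
    ← poch_div_factorial_eq_choose] at h
  rwa [Complex.cpow_neg, ← one_div]

/-- Pfaff's transformation, near the origin. -/
theorem gaussSeries_pfaff (a b : ℂ) {c : ℂ} (hc : 0 < c.re) :
    ∀ᶠ y in 𝓝 (0 : ℂ),
      (1 - y) ^ (-a) * gaussSeries a (c - b) c (y / (y - 1)) = gaussSeries a b c y := by
  obtain ⟨A, hA⟩ := exists_nat_ge ‖a‖
  filter_upwards [Metric.ball_mem_nhds (0 : ℂ) (by norm_num : (0 : ℝ) < 1 / 2)] with y hy
  rw [mem_ball_zero_iff] at hy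
  have hy1 : ‖y‖ < 1 := by linarith
  have hy0 := norm_nonneg y
  have h1y : (1 - y) ≠ 0 := fun h => by
    rw [sub_eq_zero] at h; rw [← h] at hy1; simp at hy1
  -- The majorant below sums over its second index to a multiple of `(m+K choose K) r^m`; `‖y‖ <
  -- 1/2` is exactly what makes `r < 1`.
  set r : ℝ := ‖y‖ / (1 - ‖y‖) with hr
  have hr0 : 0 ≤ r := div_nonneg hy0 (by linarith)
  have hr1 : r < 1 := by rw [hr, div_lt_one (by linarith)]; linarith
  -- Since `y/(y-1) = -y/(1-y)`, the `m`-th term on the left carries `(1-y)^{-(a+m)}`; `f` expands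
  -- this power by the binomial series.
  let f : ℕ × ℕ → ℂ := fun p =>
    gaussCoeff a (c - b) c p.1 * (-y) ^ p.1 * (poch (a + p.1) p.2 / p.2.factorial * y ^ p.2)
  obtain ⟨C, K, hC, hCK⟩ := exists_gaussCoeff_bound a (c - b) hc
  have hsum : Summable f := by
    let g : ℕ × ℕ → ℝ := fun p => C * (p.1 + K).choose K * ‖y‖ ^ p.1 *
      ((p.2 + (A + p.1)).choose (A + p.1) * ‖y‖ ^ p.2)
    have hin : ∀ m : ℕ, HasSum (fun k => g (m, k))
        (C * (m + K).choose K * ‖y‖ ^ m * (1 / (1 - ‖y‖) ^ (A + m + 1))) := fun m =>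
      (summable_choose_mul_pow (A + m) hy0 hy1).mul_left _
    have hg : Summable g := by
      refine (summable_prod_of_nonneg (fun p => by positivity)).2
        ⟨fun m => (hin m).summable, ?_⟩
      simp_rw [fun m => (hin m).tsum_eq]
      refine ((summable_choose_mul_pow K hr0 hr1).summable.mul_left
        (C * (1 / (1 - ‖y‖) ^ (A + 1)))).congr fun m => ?_
      have : (1 - ‖y‖) ≠ 0 := by linarith
      rw [hr, div_pow]
      field_simp
      ring
    refine .of_norm_bounded hg fun p => ?_
    simp only [f, g, norm_mul, norm_pow, norm_neg, norm_div, Complex.norm_natCast]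
    have hp : ‖a + p.1‖ ≤ ((A + p.1 : ℕ) : ℝ) + 1 := by
      refine (norm_add_le _ _).trans ?_
      simp; linarith
    have := norm_poch_le hp p.2
    gcongr
    · exact hCK _
    · rw [div_le_iff₀ (by positivity), mul_comm]; exact this
  have h1 : HasSum f ((1 - y) ^ (-a) * gaussSeries a (c - b) c (y / (y - 1))) := by
    have hxn : ‖y / (y - 1)‖ < 1 := by
      have : 1 - ‖y‖ ≤ ‖y - 1‖ := by
        have := norm_sub_norm_le (1 : ℂ) y
        rw [norm_sub_rev]; simpa using this
      rw [norm_div, div_lt_one (by linarith)]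
      linarith
    have h2 : HasSum (fun m : ℕ => gaussCoeff a (c - b) c m * (-y) ^ m * (1 - y) ^ (-(a + m)))
        ((1 - y) ^ (-a) * gaussSeries a (c - b) c (y / (y - 1))) := by
      refine ((hasSum_gaussSeries a (c - b) hc hxn).mul_left ((1 - y) ^ (-a))).congr_fun fun m => ?_
      rw [neg_add, Complex.cpow_add _ _ h1y, Complex.cpow_neg _ (m : ℂ), Complex.cpow_natCast,
        show y / (y - 1) = (-y) / (1 - y) by rw [← neg_div_neg_eq, neg_sub], div_pow]
      ring
    have h3 := hsum.hasSum.prod_fiberwise fun m =>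
      (hasSum_one_sub_cpow_neg (a + m) hy1).mul_left (gaussCoeff a (c - b) c m * (-y) ^ m)
    rw [h2.unique h3]
    exact hsum.hasSum
  -- Collecting the powers `y^N`: by `(a)_m (a+m)_{N-m} = (a)_N` the coefficient becomes a
  -- Chu–Vandermonde sum.
  have h4 : HasSum (fun N => ∑ p ∈ Finset.HasAntidiagonal.antidiagonal N, f p)
      ((1 - y) ^ (-a) * gaussSeries a (c - b) c (y / (y - 1))) := by
    have h5 := (Finset.HasAntidiagonal.sigmaAntidiagonalEquivProd.hasSum_iff).2 h1
    refine (h5.sigma fun N => ?_)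
    rw [← Finset.sum_coe_sort]
    exact hasSum_fintype _
  refine h4.unique ?_
  convert hasSum_gaussSeries a b hc hy1 using 2 with N
  rw [Finset.Nat.sum_antidiagonal_eq_sum_range_succ_mk]
  have hcn := ne_neg_natCast_of_re_pos hc
  have h6 : gaussCoeff a b c N = poch a N / N.factorial * (poch b N / poch c N) := by
    rw [gaussCoeff]; field_simp
  rw [h6, ← sum_choose_poch_div_poch N b hc, Finset.mul_sum, Finset.sum_mul]
  refine Finset.sum_congr rfl fun m hm => ?_
  have hmN : m ≤ N := Nat.lt_succ_iff.1 (Finset.mem_range.1 hm)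
  obtain ⟨k, rfl⟩ := Nat.exists_eq_add_of_le hmN
  have := poch_ne_zero hcn m
  simp only [f, gaussCoeff, Nat.add_sub_cancel_left]
  rw [poch_add, Nat.cast_choose ℂ hmN, Nat.add_sub_cancel_left, neg_pow y, pow_add]
  have h7 : ((m + k).factorial : ℂ) ≠ 0 := by exact_mod_cast (m + k).factorial_ne_zero
  have h8 : (m.factorial : ℂ) ≠ 0 := by exact_mod_cast m.factorial_ne_zero
  have h9 : (k.factorial : ℂ) ≠ 0 := by exact_mod_cast k.factorial_ne_zero
  generalize poch c m = p1 at *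
  generalize ((m + k).factorial : ℂ) = p2 at *
  generalize (m.factorial : ℂ) = p3 at *
  generalize (k.factorial : ℂ) = p4 at *
  generalize (-1 : ℂ) ^ m = p5
  generalize y ^ m = p6
  generalize y ^ k = p7
  clear * - this h7 h8 h9
  field_simp

/-! ### Gauss's summation theorem -/

theorem norm_le_norm_add_natCast {c : ℂ} (hc : 0 < c.re) (m : ℕ) : ‖c‖ ≤ ‖c + m‖ := by
  rw [Complex.norm_def, Complex.norm_def]
  apply Real.sqrt_le_sqrt
  simp only [Complex.normSq_apply, Complex.add_re, Complex.add_im, Complex.natCast_re,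
    Complex.natCast_im, add_zero]
  have : (0 : ℝ) ≤ m := m.cast_nonneg
  nlinarith

theorem add_natCast_ne_zero {c : ℂ} (hc : 0 < c.re) (m : ℕ) : c + m ≠ 0 := fun h =>
  ne_neg_natCast_of_re_pos hc m (eq_neg_of_add_eq_zero_left h)

theorem gaussCoeff_add_one (a b : ℂ) {c : ℂ} (hc : 0 < c.re) (m : ℕ) :
    gaussCoeff a b (c + 1) m * (c + m) = gaussCoeff a b c m * c := by
  have h : c * poch (c + 1) m = poch c m * (c + m) := by rw [← poch_succ_left, poch_succ]
  have hc1 : 0 < (c + 1).re := by simp; linarith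
  have h1 := poch_ne_zero (ne_neg_natCast_of_re_pos hc1) m
  have h2 := poch_ne_zero (ne_neg_natCast_of_re_pos hc) m
  have h3 : (m.factorial : ℂ) ≠ 0 := by exact_mod_cast m.factorial_ne_zero
  simp only [gaussCoeff]
  field_simp
  linear_combination -(poch a m * poch b m) * h

theorem norm_gaussCoeff_add_one_le (a b : ℂ) {c : ℂ} (hc : 0 < c.re) (m : ℕ) :
    ‖gaussCoeff a b (c + 1) m‖ ≤ ‖gaussCoeff a b c m‖ := by
  have h := congrArg norm (gaussCoeff_add_one a b hc m)
  rw [norm_mul, norm_mul] at h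
  have h1 := norm_le_norm_add_natCast hc m
  have h0 : 0 < ‖c‖ := norm_pos_iff.2 fun h => by simp [h] at hc
  refine le_of_mul_le_mul_right ?_ h0
  rw [← h]
  gcongr

theorem norm_gaussCoeff_add_natCast_le (a b : ℂ) {c : ℂ} (hc : 0 < c.re) (n m : ℕ) :
    ‖gaussCoeff a b (c + n) m‖ ≤ ‖gaussCoeff a b c m‖ := by
  induction n with
  | zero => simp
  | succ n ih =>
    refine le_trans ?_ ih
    push_cast
    rw [← add_assoc]
    exact norm_gaussCoeff_add_one_le a b (by simp; linarith [(n.cast_nonneg : (0 : ℝ) ≤ n)]) m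

/-- Raising `c` by one gains a factor `c/(c+m)`, which pays for the factor `m`. This is the
vanishing boundary term in the telescoping of `tsum_gaussCoeff_recurrence`. -/
theorem tendsto_natCast_mul_gaussCoeff_add_one (a b : ℂ) {c : ℂ} (hc : 0 < c.re)
    (hs : Summable (gaussCoeff a b c)) :
    Tendsto (fun m : ℕ => (m : ℂ) * gaussCoeff a b (c + 1) m) atTop (𝓝 0) := by
  have h0 := (hs.tendsto_atTop_zero.mul_const c).norm
  simp only [zero_mul, norm_zero] at h0
  refine squeeze_zero_norm (fun m => ?_) h0
  rw [← gaussCoeff_add_one a b hc m, norm_mul, norm_mul, mul_comm]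
  gcongr
  refine le_trans ?_ (Complex.re_le_norm _)
  simp; linarith

/-- Gauss's contiguous relation: the difference of the two sides, taken term by term, telescopes in
`m · gaussCoeff a b c m`. -/
theorem tsum_gaussCoeff_recurrence (a b : ℂ) {c : ℂ} (hc : 0 < c.re)
    (hs : Summable (gaussCoeff a b c))
    (ht : Tendsto (fun m : ℕ => (m : ℂ) * gaussCoeff a b c m) atTop (𝓝 0)) :
    (c - a - b) * c * ∑' m, gaussCoeff a b c m
      = (c - a) * (c - b) * ∑' m, gaussCoeff a b (c + 1) m := by
  have hs1 : Summable (gaussCoeff a b (c + 1)) :=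
    .of_norm_bounded hs.norm (norm_gaussCoeff_add_one_le a b hc)
  have h1 : ∀ m : ℕ, (c - a - b) * c * gaussCoeff a b c m
      - (c - a) * (c - b) * gaussCoeff a b (c + 1) m
      = c * (m * gaussCoeff a b c m - (m + 1 : ℕ) * gaussCoeff a b c (m + 1)) := by
    intro m
    have hm := add_natCast_ne_zero hc m
    have h2 : gaussCoeff a b (c + 1) m = gaussCoeff a b c m * c / (c + m) := by
      rw [eq_div_iff hm, gaussCoeff_add_one a b hc]
    have h3 : (m : ℂ) + 1 ≠ 0 := by exact_mod_cast m.succ_ne_zero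
    rw [h2, gaussCoeff_succ]
    push_cast
    field_simp
    ring
  have h4 : HasSum (fun m : ℕ => c * (m * gaussCoeff a b c m
      - (m + 1 : ℕ) * gaussCoeff a b c (m + 1)))
      ((c - a - b) * c * ∑' m, gaussCoeff a b c m
      - (c - a) * (c - b) * ∑' m, gaussCoeff a b (c + 1) m) := by
    simp_rw [← h1]
    exact (hs.hasSum.mul_left _).sub (hs1.hasSum.mul_left _)
  have h5 := h4.tendsto_sum_nat
  have h6 : Tendsto (fun n : ℕ => ∑ m ∈ Finset.range n, c * ((m : ℂ) * gaussCoeff a b c m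
      - (m + 1 : ℕ) * gaussCoeff a b c (m + 1))) atTop (𝓝 (c * (0 - 0))) := by
    simp_rw [← Finset.mul_sum, Finset.sum_range_sub' (fun m : ℕ => (m : ℂ) * gaussCoeff a b c m)]
    simpa using (ht.const_sub 0).const_mul c
  have := tendsto_nhds_unique h5 h6
  simp only [sub_self, mul_zero] at this
  exact sub_eq_zero.1 this

/-- Every coefficient of positive index tends to `0` as `c` moves to the right, and the series at
`c` dominates all the others. -/
theorem tendsto_tsum_gaussCoeff_add_natCast (a b : ℂ) {c : ℂ} (hc : 0 < c.re)
    (hs : Summable (gaussCoeff a b c)) :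
    Tendsto (fun n : ℕ => ∑' m, gaussCoeff a b (c + n) m) atTop (𝓝 1) := by
  have h : ∑' m, (if m = 0 then (1 : ℂ) else 0) = 1 := tsum_ite_eq 0 _
  rw [← h]
  refine tendsto_tsum_of_dominated_convergence hs.norm (fun m => ?_)
    (.of_forall fun n m => norm_gaussCoeff_add_natCast_le a b hc n m)
  have hinf : ∀ m : ℕ, Tendsto (fun n : ℕ => c + n + m) atTop (Bornology.cobounded ℂ) := fun m => by
    refine tendsto_norm_atTop_iff_cobounded.1
      (tendsto_atTop_mono (fun n => ?_) tendsto_natCast_atTop_atTop)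
    refine le_trans ?_ (Complex.re_le_norm _)
    simp; linarith [(m.cast_nonneg : (0 : ℝ) ≤ m)]
  induction m with
  | zero => simp
  | succ m ih =>
    simp only [Nat.succ_ne_zero, if_false, gaussCoeff_succ]
    have hb : Tendsto (fun n : ℕ => (a + m) * (b + m) / ((c + n + m) * (m + 1))) atTop (𝓝 0) := by
      have := ((tendsto_inv₀_cobounded.comp (hinf m)).const_mul ((a + m) * (b + m) / (m + 1)))
      rw [mul_zero] at this
      refine this.congr fun n => ?_
      simp only [Function.comp_apply]
      rw [div_eq_mul_inv, div_eq_mul_inv, mul_inv]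
      ring
    simpa using ih.mul hb

/-- The powers of `n` cancel because `c + (c-a-b) = (c-a) + (c-b)`, leaving the finite products of
Euler's limit for `Γ`. -/
theorem prod_ratio_eq_GammaSeq (a b : ℂ) {c : ℂ} (h1 : 0 < c.re) (h2 : 0 < (c - a - b).re)
    (h3 : 0 < (c - a).re) (h4 : 0 < (c - b).re) {n : ℕ} (hn : n ≠ 0) :
    ∏ j ∈ Finset.range (n + 1), ((c + j - a) * (c + j - b) / ((c + j - a - b) * (c + j)))
      = Complex.GammaSeq c n * Complex.GammaSeq (c - a - b) n
        / (Complex.GammaSeq (c - a) n * Complex.GammaSeq (c - b) n) := by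
  have hn' : (n : ℂ) ≠ 0 := by exact_mod_cast hn
  have hp : ∀ {d : ℂ}, 0 < d.re → ∏ j ∈ Finset.range (n + 1), (d + (j : ℂ)) ≠ 0 := fun hd =>
    Finset.prod_ne_zero_iff.2 fun j _ => add_natCast_ne_zero hd j
  have e : (n : ℂ) ^ c * (n : ℂ) ^ (c - a - b) = (n : ℂ) ^ (c - a) * (n : ℂ) ^ (c - b) := by
    rw [← Complex.cpow_add _ _ hn', ← Complex.cpow_add _ _ hn']
    ring_nf
  have q1 := hp h1
  have q2 := hp h2
  have q3 := hp h3
  have q4 := hp h4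
  have hf : (n.factorial : ℂ) ≠ 0 := by exact_mod_cast n.factorial_ne_zero
  have r3 : (n : ℂ) ^ (c - a) ≠ 0 := by simp [Complex.cpow_eq_zero_iff, hn]
  have r4 : (n : ℂ) ^ (c - b) ≠ 0 := by simp [Complex.cpow_eq_zero_iff, hn]
  rw [Finset.prod_div_distrib, Finset.prod_mul_distrib, Finset.prod_mul_distrib]
  simp_rw [fun j : ℕ => show c + (j : ℂ) - a = c - a + j by ring,
    fun j : ℕ => show c + (j : ℂ) - b = c - b + j by ring,
    fun j : ℕ => show c - a + (j : ℂ) - b = c - a - b + j by ring]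
  simp only [Complex.GammaSeq]
  generalize ∏ j ∈ Finset.range (n + 1), (c + (j : ℂ)) = p1 at *
  generalize ∏ j ∈ Finset.range (n + 1), (c - a - b + (j : ℂ)) = p2 at *
  generalize ∏ j ∈ Finset.range (n + 1), (c - a + (j : ℂ)) = p3 at *
  generalize ∏ j ∈ Finset.range (n + 1), (c - b + (j : ℂ)) = p4 at *
  generalize (n : ℂ) ^ c = t1 at *
  generalize (n : ℂ) ^ (c - a - b) = t2 at *
  generalize (n : ℂ) ^ (c - a) = t3 at *
  generalize (n : ℂ) ^ (c - b) = t4 at *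
  generalize (n.factorial : ℂ) = f at *
  clear * - e q1 q2 q3 q4 hf r3 r4
  field_simp
  linear_combination -e

/-- Gauss's summation theorem, in the range where the series with `c - 1` still converges. -/
theorem tsum_gaussCoeff (a b : ℂ) {c : ℂ} (hc : 0 < c.re)
    (hs : Summable (gaussCoeff a b c)) (h2 : 0 < (c + 1 - a - b).re)
    (h3 : 0 < (c + 1 - a).re) (h4 : 0 < (c + 1 - b).re) :
    ∑' m, gaussCoeff a b (c + 1) m = Complex.Gamma (c + 1) * Complex.Gamma (c + 1 - a - b)
        / (Complex.Gamma (c + 1 - a) * Complex.Gamma (c + 1 - b)) := by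
  have hpos : ∀ n : ℕ, 0 < (c + n).re := fun n => by
    simp; linarith [(n.cast_nonneg : (0 : ℝ) ≤ n)]
  have hsn : ∀ n : ℕ, Summable (gaussCoeff a b (c + n)) := fun n =>
    .of_norm_bounded hs.norm (norm_gaussCoeff_add_natCast_le a b hc n)
  have hc1 : 0 < (c + 1).re := by simpa using hpos 1
  have hrec : ∀ n : ℕ, ∑' m, gaussCoeff a b (c + 1 + n) m
      = ((c + 1 + n - a) * (c + 1 + n - b) / ((c + 1 + n - a - b) * (c + 1 + n)))
        * ∑' m, gaussCoeff a b (c + 1 + (n + 1 : ℕ)) m := by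
    intro n
    have h := tsum_gaussCoeff_recurrence a b (c := c + 1 + n)
      (by have := hpos (n + 1); push_cast at this; rwa [add_right_comm, add_assoc])
      (by have := hsn (n + 1); push_cast at this; rwa [add_right_comm, add_assoc])
      (by
        have := tendsto_natCast_mul_gaussCoeff_add_one a b (hpos n) (hsn n)
        rwa [add_right_comm] at this)
    have e1 : c + 1 + n ≠ 0 := add_natCast_ne_zero hc1 n
    have e2 : c + 1 + n - a - b ≠ 0 := by
      have := add_natCast_ne_zero h2 n
      rwa [show c + 1 + n - a - b = c + 1 - a - b + n by ring]
    push_cast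
    rw [← add_assoc, div_mul_eq_mul_div, eq_div_iff (mul_ne_zero e2 e1), ← h]
    ring
  -- Iterating the contiguous relation pushes the parameter to infinity: the remaining series tends
  -- to `1`, the product to the Gamma quotient.
  have hprod : ∀ n : ℕ, ∑' m, gaussCoeff a b (c + 1) m
      = (∏ j ∈ Finset.range n,
          ((c + 1 + j - a) * (c + 1 + j - b) / ((c + 1 + j - a - b) * (c + 1 + j))))
        * ∑' m, gaussCoeff a b (c + 1 + n) m := by
    intro n
    induction n with
    | zero => simp
    | succ n ih => rw [ih, hrec n, Finset.prod_range_succ, mul_assoc]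
  have hG := ((Complex.GammaSeq_tendsto_Gamma (c + 1)).mul
    (Complex.GammaSeq_tendsto_Gamma (c + 1 - a - b))).div
    ((Complex.GammaSeq_tendsto_Gamma (c + 1 - a)).mul (Complex.GammaSeq_tendsto_Gamma (c + 1 - b)))
    (mul_ne_zero (Complex.Gamma_ne_zero_of_re_pos h3) (Complex.Gamma_ne_zero_of_re_pos h4))
  have hs1 := hsn 1
  rw [Nat.cast_one] at hs1
  have hT := (tendsto_tsum_gaussCoeff_add_natCast a b hc1 hs1).comp (tendsto_add_atTop_nat 1)
  have hlim := hG.mul hT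
  rw [mul_one] at hlim
  refine tendsto_nhds_unique (tendsto_const_nhds.congr' ?_) hlim
  filter_upwards [eventually_ne_atTop 0] with n hn
  rw [hprod (n + 1), prod_ratio_eq_GammaSeq a b hc1 h2 h3 h4 hn]
  rfl

/-! ### Laplace transforms of hypergeometric kernels -/

/-- `1 - e^{-u}`. -/
def oneSubExp (u : ℝ) : ℝ := 1 - Real.exp (-u)

theorem continuous_oneSubExp : Continuous oneSubExp := by unfold oneSubExp; fun_prop

theorem oneSubExp_pos {u : ℝ} (hu : 0 < u) : 0 < oneSubExp u := by simp [oneSubExp, hu]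

theorem oneSubExp_lt_one (u : ℝ) : oneSubExp u < 1 := by simp [oneSubExp, Real.exp_pos]

theorem norm_oneSubExp {u : ℝ} (hu : 0 < u) : ‖(oneSubExp u : ℂ)‖ = oneSubExp u := by
  rw [Complex.norm_real, Real.norm_of_nonneg (oneSubExp_pos hu).le]

theorem norm_oneSubExp_lt_one {u : ℝ} (hu : 0 < u) : ‖(oneSubExp u : ℂ)‖ < 1 := by
  rw [norm_oneSubExp hu]; exact oneSubExp_lt_one u

theorem image_exp_neg_Ioi : (fun u : ℝ => Real.exp (-u)) '' Ioi 0 = Ioo 0 1 := by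
  ext x
  constructor
  · rintro ⟨u, hu, rfl⟩
    exact ⟨Real.exp_pos _, by simpa using hu⟩
  · rintro ⟨h0, h1⟩
    exact ⟨-Real.log x, by simpa using Real.log_neg h0 h1, by simp [Real.exp_log h0]⟩

theorem hasDerivWithinAt_exp_neg (u : ℝ) (s : Set ℝ) :
    HasDerivWithinAt (fun u : ℝ => Real.exp (-u)) (-Real.exp (-u)) s u := by
  have := ((hasDerivAt_neg u).exp).hasDerivWithinAt (s := s)
  simpa using this

theorem injOn_exp_neg (s : Set ℝ) : InjOn (fun u : ℝ => Real.exp (-u)) s := fun u _ v _ h => by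
  simpa using h

theorem ofReal_cpow_eq_exp {x : ℝ} (hx : 0 < x) (s : ℂ) :
    (x : ℂ) ^ s = Complex.exp (s * Real.log x) := by
  rw [Complex.cpow_def_of_ne_zero (by exact_mod_cast hx.ne'), Complex.ofReal_log hx.le, mul_comm]

theorem ofReal_exp_cpow (u : ℝ) (s : ℂ) : ((Real.exp u : ℝ) : ℂ) ^ s = Complex.exp (s * u) := by
  rw [ofReal_cpow_eq_exp (Real.exp_pos u), Real.log_exp]

theorem betaIntegrand_exp_neg (s c : ℂ) (u : ℝ) :
    |-Real.exp (-u)| • (((Real.exp (-u) : ℝ) : ℂ) ^ (s - 1) * (1 - ((Real.exp (-u) : ℝ) : ℂ)) ^ (c - 1))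
      = Complex.exp (-(s * u)) * (oneSubExp u : ℂ) ^ (c - 1) := by
  rw [abs_neg, abs_of_pos (Real.exp_pos _), ofReal_exp_cpow, Complex.real_smul, ← mul_assoc,
    Complex.ofReal_exp, ← Complex.exp_add, oneSubExp]
  push_cast
  ring_nf

theorem integrableOn_exp_mul_oneSubExp_cpow {s c : ℂ} (hs : 0 < s.re) (hc : 0 < c.re) :
    IntegrableOn (fun u : ℝ => Complex.exp (-(s * u)) * (oneSubExp u : ℂ) ^ (c - 1)) (Ioi 0) := by
  have h := Complex.betaIntegral_convergent hs hc
  rw [intervalIntegrable_iff_integrableOn_Ioo_of_le zero_le_one, ← image_exp_neg_Ioi,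
    integrableOn_image_iff_integrableOn_abs_deriv_smul measurableSet_Ioi
      (fun u _ => hasDerivWithinAt_exp_neg u _) (injOn_exp_neg _)] at h
  simpa only [betaIntegrand_exp_neg] using h

theorem integral_exp_mul_oneSubExp_cpow {s c : ℂ} (hs : 0 < s.re) (hc : 0 < c.re) :
    ∫ u : ℝ in Ioi 0, Complex.exp (-(s * u)) * (oneSubExp u : ℂ) ^ (c - 1)
      = Complex.Gamma s * Complex.Gamma c / Complex.Gamma (s + c) := by
  rw [← Complex.betaIntegral_eq_Gamma_mul_div s c hs hc, Complex.betaIntegral,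
    intervalIntegral.integral_of_le zero_le_one, integral_Ioc_eq_integral_Ioo,
    ← image_exp_neg_Ioi, integral_image_eq_integral_abs_deriv_smul measurableSet_Ioi
      (fun u _ => hasDerivWithinAt_exp_neg u _) (injOn_exp_neg _)]
  simp only [betaIntegrand_exp_neg]

theorem continuousOn_gaussSeries_oneSubExp (a b : ℂ) {c : ℂ} (hc : 0 < c.re) :
    ContinuousOn (fun u : ℝ => gaussSeries a b c (oneSubExp u)) (Ioi 0) :=
  (differentiableOn_gaussSeries a b hc).continuousOn.comp
    (Complex.continuous_ofReal.comp continuous_oneSubExp).continuousOn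
    fun u hu => by simpa using norm_oneSubExp_lt_one hu

theorem continuousOn_oneSubExp_cpow (c : ℂ) :
    ContinuousOn (fun u : ℝ => (oneSubExp u : ℂ) ^ c) (Ioi 0) := by
  intro u hu
  refine (ContinuousAt.cpow (Complex.continuous_ofReal.comp continuous_oneSubExp).continuousAt
    continuousAt_const ?_).continuousWithinAt
  simp [Complex.ofReal_mem_slitPlane, oneSubExp_pos hu]

/-- The Laplace transform of `(1 - e^{-u})^{c-1} ₂F₁(a, b; c; 1 - e^{-u})`, far to the right. -/
theorem exists_laplace_gaussSeries (a b : ℂ) {c : ℂ} (hc : 0 < c.re) :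
    ∃ S : ℝ, ∀ s : ℂ, S < s.re →
      IntegrableOn (fun u : ℝ => Complex.exp (-(s * u)) *
        ((oneSubExp u : ℂ) ^ (c - 1) * gaussSeries a b c (oneSubExp u))) (Ioi 0) ∧
      ∫ u : ℝ in Ioi 0, Complex.exp (-(s * u)) *
        ((oneSubExp u : ℂ) ^ (c - 1) * gaussSeries a b c (oneSubExp u))
      = Complex.Gamma c * Complex.Gamma s * Complex.Gamma (s + c - a - b)
        / (Complex.Gamma (s + c - a) * Complex.Gamma (s + c - b)) := by
  obtain ⟨C, K, hC, hCK⟩ := exists_gaussCoeff_bound a b hc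
  have hcont : ∀ s : ℂ, Continuous fun u : ℝ => Complex.exp (-(s * u)) := fun s => by fun_prop
  -- Termwise beta integrals replace `(c)_m` by `(s+c)_m`, so the transform is, up to Gamma factors,
  -- the Gauss series at argument `1` with parameter `s + c`.
  have main : ∀ s : ℂ, K + 1 < s.re →
      IntegrableOn (fun u : ℝ => Complex.exp (-(s * u)) *
        ((oneSubExp u : ℂ) ^ (c - 1) * gaussSeries a b c (oneSubExp u))) (Ioi 0) ∧
      HasSum (fun m => gaussCoeff a b (s + c) m)
        (Complex.Gamma (s + c) / (Complex.Gamma s * Complex.Gamma c) *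
        ∫ u : ℝ in Ioi 0, Complex.exp (-(s * u)) *
        ((oneSubExp u : ℂ) ^ (c - 1) * gaussSeries a b c (oneSubExp u))) := by
    intro s hs
    have hs0 : 0 < s.re := by linarith [(K.cast_nonneg : (0 : ℝ) ≤ K)]
    let F : ℕ → ℝ → ℂ := fun m u => Complex.exp (-(s * u)) *
      ((oneSubExp u : ℂ) ^ (c - 1) * (gaussCoeff a b c m * (oneSubExp u : ℂ) ^ m))
    let B : ℕ → ℝ → ℝ := fun m u => ‖Complex.exp (-(s * u)) * (oneSubExp u : ℂ) ^ (c - 1)‖ * C *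
      ((m + K).choose K * oneSubExp u ^ m)
    have hB : ∀ u ∈ Ioi (0 : ℝ), HasSum (fun m => B m u)
        -- Summing `(m+K choose K)(1 - e^{-u})^m` gives `e^{(K+1)u}`: domination costs a shift of
        -- `s` by `K + 1`, hence the condition `K + 1 < Re s`.
        (C * ‖Complex.exp (-((s - (K + 1 : ℕ)) * u)) * (oneSubExp u : ℂ) ^ (c - 1)‖) := by
      intro u hu
      have h := (summable_choose_mul_pow K (oneSubExp_pos hu).le (oneSubExp_lt_one u)).mul_left
        (‖Complex.exp (-(s * u)) * (oneSubExp u : ℂ) ^ (c - 1)‖ * C)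
      suffices e : C * ‖Complex.exp (-((s - (K + 1 : ℕ)) * u)) * (oneSubExp u : ℂ) ^ (c - 1)‖
          = ‖Complex.exp (-(s * u)) * (oneSubExp u : ℂ) ^ (c - 1)‖ * C *
            (1 / (1 - oneSubExp u) ^ (K + 1)) by rw [e]; exact h
      have e1 : 1 / (1 - oneSubExp u) ^ (K + 1) = Real.exp (((K + 1 : ℕ) : ℝ) * u) := by
        rw [oneSubExp, sub_sub_cancel, ← Real.exp_nat_mul, one_div, ← Real.exp_neg]
        ring_nf
      rw [e1, norm_mul, norm_mul, Complex.norm_exp, Complex.norm_exp,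
        show (-((s - (K + 1 : ℕ)) * u) : ℂ).re = (-(s * u)).re + ((K + 1 : ℕ) : ℝ) * u by
          simp; ring, Real.exp_add]
      ring
    have hFB : ∀ m, ∀ u ∈ Ioi (0 : ℝ), ‖F m u‖ ≤ B m u := by
      intro m u hu
      simp only [F, B]
      rw [← mul_assoc, norm_mul, norm_mul (gaussCoeff a b c m), norm_pow, norm_oneSubExp hu,
        mul_assoc _ C, ← mul_assoc C]
      have := (oneSubExp_pos hu).le
      gcongr
      exact hCK m
    have hlim : ∀ u ∈ Ioi (0 : ℝ), HasSum (fun m => F m u) (Complex.exp (-(s * u)) *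
        ((oneSubExp u : ℂ) ^ (c - 1) * gaussSeries a b c (oneSubExp u))) := fun u hu =>
      ((hasSum_gaussSeries a b hc (norm_oneSubExp_lt_one hu)).mul_left _).mul_left _
    have hint : IntegrableOn (fun u : ℝ =>
        C * ‖Complex.exp (-((s - (K + 1 : ℕ)) * u)) * (oneSubExp u : ℂ) ^ (c - 1)‖) (Ioi 0) :=
      ((integrableOn_exp_mul_oneSubExp_cpow (by simp; linarith) hc).norm).const_mul C
    have hmeas : ∀ {g : ℝ → ℂ}, ContinuousOn g (Ioi 0) →
        AEStronglyMeasurable (fun u : ℝ => Complex.exp (-(s * u)) *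
          ((oneSubExp u : ℂ) ^ (c - 1) * g u)) (volume.restrict (Ioi 0)) := fun hg =>
      ((hcont s).continuousOn.mul ((continuousOn_oneSubExp_cpow (c - 1)).mul hg)).aestronglyMeasurable
        measurableSet_Ioi
    refine ⟨?_, ?_⟩
    · refine hint.mono' (hmeas (continuousOn_gaussSeries_oneSubExp a b hc)) ?_
      filter_upwards [ae_restrict_mem measurableSet_Ioi] with u hu
      have hsm : Summable fun m => ‖F m u‖ :=
        .of_nonneg_of_le (fun _ => norm_nonneg _) (fun m => hFB m u hu) (hB u hu).summable
      rw [← (hlim u hu).tsum_eq, ← (hB u hu).tsum_eq]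
      exact (norm_tsum_le_tsum_norm hsm).trans
        (hsm.tsum_le_tsum (fun m => hFB m u hu) (hB u hu).summable)
    · have hsum := hasSum_integral_of_dominated_convergence (μ := volume.restrict (Ioi (0 : ℝ)))
        (F := F) B
        (fun m => hmeas (continuousOn_const.mul
          ((Complex.continuous_ofReal.comp continuous_oneSubExp).continuousOn.pow m)))
        (fun m => by
          filter_upwards [ae_restrict_mem measurableSet_Ioi] with u hu using hFB m u hu)
        (by filter_upwards [ae_restrict_mem measurableSet_Ioi] with u hu using (hB u hu).summable)
        (hint.congr (by
          filter_upwards [ae_restrict_mem measurableSet_Ioi] with u hu using (hB u hu).tsum_eq.symm))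
        (by filter_upwards [ae_restrict_mem measurableSet_Ioi] with u hu using hlim u hu)
      refine (hsum.mul_left
        (Complex.Gamma (s + c) / (Complex.Gamma s * Complex.Gamma c))).congr_fun fun m => ?_
      have hcm : 0 < (c + m).re := by simp; linarith [(m.cast_nonneg : (0 : ℝ) ≤ m)]
      have hsc : 0 < (s + c).re := by simp; linarith
      have e1 : ∫ u : ℝ in Ioi 0, F m u = gaussCoeff a b c m *
          (Complex.Gamma s * Complex.Gamma (c + m) / Complex.Gamma (s + (c + m))) := by
        rw [← integral_exp_mul_oneSubExp_cpow hs0 hcm, ← integral_const_mul]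
        refine setIntegral_congr_fun measurableSet_Ioi fun u hu => ?_
        have : (oneSubExp u : ℂ) ≠ 0 := by exact_mod_cast (oneSubExp_pos hu).ne'
        simp only [F]
        rw [show c + m - 1 = c - 1 + m by ring, Complex.cpow_add _ _ this, Complex.cpow_natCast]
        ring
      rw [e1, ← add_assoc, ← poch_mul_Gamma (ne_neg_natCast_of_re_pos hc),
        ← poch_mul_Gamma (ne_neg_natCast_of_re_pos hsc)]
      have g1 := Complex.Gamma_ne_zero_of_re_pos hs0
      have g2 := Complex.Gamma_ne_zero_of_re_pos hc
      have g3 := Complex.Gamma_ne_zero_of_re_pos hsc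
      have g4 := poch_ne_zero (ne_neg_natCast_of_re_pos hc) m
      have g5 := poch_ne_zero (ne_neg_natCast_of_re_pos hsc) m
      have g6 : (m.factorial : ℂ) ≠ 0 := by exact_mod_cast m.factorial_ne_zero
      simp only [gaussCoeff]
      field_simp
  -- One unit beyond `K + 1` lets `main` be applied at `s - 1`, which supplies the summability that
  -- `tsum_gaussCoeff` asks for; `‖a‖ + ‖b‖` keeps the Gamma arguments in the right half-plane.
  refine ⟨K + 2 + ‖a‖ + ‖b‖, fun s hs => ?_⟩
  have ha := Complex.abs_re_le_norm a
  have hb := Complex.abs_re_le_norm b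
  have ha' := abs_le.1 ha
  have hb' := abs_le.1 hb
  have hK : (0 : ℝ) ≤ K := K.cast_nonneg
  have na := norm_nonneg a
  have nb := norm_nonneg b
  obtain ⟨hi, hsum⟩ := main s (by linarith)
  refine ⟨hi, ?_⟩
  have hs1 := (main (s - 1) (by simp; linarith)).2.summable
  have hG := tsum_gaussCoeff a b (c := s - 1 + c) (by simp; linarith) hs1
    (by simp; linarith) (by simp; linarith) (by simp; linarith)
  rw [show s - 1 + c + 1 = s + c by ring, hsum.tsum_eq] at hG
  have g1 := Complex.Gamma_ne_zero_of_re_pos (s := s) (by linarith)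
  have g2 := Complex.Gamma_ne_zero_of_re_pos hc
  have g3 := Complex.Gamma_ne_zero_of_re_pos (s := s + c) (by simp; linarith)
  have g4 := Complex.Gamma_ne_zero_of_re_pos (s := s + c - a) (by simp; linarith)
  have g5 := Complex.Gamma_ne_zero_of_re_pos (s := s + c - b) (by simp; linarith)
  generalize (∫ u : ℝ in Ioi 0, Complex.exp (-(s * u)) *
        ((oneSubExp u : ℂ) ^ (c - 1) * gaussSeries a b c (oneSubExp u))) = I at *
  field_simp at hG ⊢
  linear_combination hG

/-! ### The holomorphic continuation of Appell's series -/

/-- The continuation of `₂F₁(a, b; c; y)` to `Re y < 1/2` by Pfaff's transformation. -/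
def pfaffSeries (a b c y : ℂ) : ℂ := (1 - y) ^ (-a) * gaussSeries a (c - b) c (y / (y - 1))

/-- Points with `Re y < 1/2` are nearer to `0` than to `1`, so `y/(y-1)` lies in the unit disc. This
half-plane contains all the values `y = 1 - e^u` with `u ≥ 0`. -/
theorem norm_lt_norm_sub_one {y : ℂ} (hy : y.re < 1 / 2) : ‖y‖ < ‖y - 1‖ := by
  rw [Complex.norm_def, Complex.norm_def]
  apply Real.sqrt_lt_sqrt (Complex.normSq_nonneg _)
  simp only [Complex.normSq_apply, Complex.sub_re, Complex.sub_im, Complex.one_re, Complex.one_im]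
  nlinarith

theorem isOpen_re_lt_half : IsOpen {y : ℂ | y.re < 1 / 2} :=
  isOpen_lt Complex.continuous_re continuous_const

theorem differentiableOn_pfaffSeries (a b : ℂ) {c : ℂ} (hc : 0 < c.re) :
    DifferentiableOn ℂ (pfaffSeries a b c) {y : ℂ | y.re < 1 / 2} := by
  have h1 : ∀ y : ℂ, y.re < 1 / 2 → y - 1 ≠ 0 := fun y hy h => by
    have := norm_lt_norm_sub_one hy
    rw [h, norm_zero] at this
    exact absurd this (norm_nonneg y).not_gt
  refine DifferentiableOn.mul ?_ ?_
  · refine DifferentiableOn.cpow_const (by fun_prop) fun y hy => ?_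
    left
    simp only [mem_ofPred_eq] at hy
    simp; linarith
  · refine (differentiableOn_gaussSeries a (c - b) hc).comp
      (differentiableOn_id.div (by fun_prop) fun y hy => h1 y hy) fun y hy => ?_
    have := norm_lt_norm_sub_one hy
    change y / (y - 1) ∈ _
    rw [mem_ball_zero_iff, norm_div, div_lt_one ((norm_nonneg y).trans_lt this)]
    exact this

/-- A domain of `ℂ × ℂ`, star-shaped about the origin, to which Appell's series is continued. -/
def f3Region : Set (ℂ × ℂ) := Metric.ball (0 : ℂ) 1 ×ˢ {y : ℂ | y.re < 1 / 2}

theorem isOpen_f3Region : IsOpen f3Region := Metric.isOpen_ball.prod isOpen_re_lt_half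

theorem zero_mem_f3Region : (0 : ℂ × ℂ) ∈ f3Region := by simp [f3Region]

theorem starConvex_f3Region : StarConvex ℝ 0 f3Region :=
  Convex.starConvex ((convex_ball _ _).prod (convex_halfSpace_re_lt _)) zero_mem_f3Region

/-- `(x, y) ↦ (u x, (1 - u) y)`. -/
def scaleMap (u : ℝ) : ℂ × ℂ →L[ℂ] ℂ × ℂ :=
  ((u : ℂ) • ContinuousLinearMap.fst ℂ ℂ ℂ).prod ((1 - u : ℂ) • ContinuousLinearMap.snd ℂ ℂ ℂ)

theorem scaleMap_apply (u : ℝ) (v : ℂ × ℂ) : scaleMap u v = (u * v.1, (1 - u) * v.2) := by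
  simp [scaleMap]

theorem continuous_scaleMap : Continuous scaleMap := by
  have : scaleMap = fun u : ℝ => (u : ℂ) • (ContinuousLinearMap.inl ℂ ℂ ℂ ∘L ContinuousLinearMap.fst ℂ ℂ ℂ)
      + (1 - u : ℂ) • (ContinuousLinearMap.inr ℂ ℂ ℂ ∘L ContinuousLinearMap.snd ℂ ℂ ℂ) := by
    ext u <;> simp [scaleMap]
  rw [this]
  fun_prop

theorem scaleMap_mem_f3Region {u : ℝ} (hu : u ∈ Icc (0 : ℝ) 1) {v : ℂ × ℂ} (hv : v ∈ f3Region) :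
    scaleMap u v ∈ f3Region := by
  rw [scaleMap_apply]
  obtain ⟨h1, h2⟩ := hv
  simp only [mem_ball_zero_iff, mem_ofPred_eq] at h1 h2
  have hu' : 0 ≤ 1 - u := by linarith [hu.2]
  refine ⟨?_, ?_⟩
  · simp only [mem_ball_zero_iff, norm_mul, Complex.norm_real, Real.norm_of_nonneg hu.1]
    nlinarith [hu.2, hu.1, norm_nonneg v.1]
  · have : ((1 - (u : ℂ)) * v.2).re = (1 - u) * v.2.re := by simp
    simp only [mem_ofPred_eq, this]
    rcases hu.1.eq_or_lt with h | h
    · rw [← h]; linarith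
    · nlinarith

/-- The weight is merely integrable, being singular at the endpoints. The derivative of the other
factor is continuous, hence bounded on the compact product of `[0, 1]` with a closed ball, and this
bound times `‖w‖` dominates. -/
theorem differentiableOn_integral_scaleMap {w : ℝ → ℂ} {g : ℂ × ℂ → ℂ}
    (hw : IntervalIntegrable w volume 0 1) (hg : ContDiffOn ℂ 1 g f3Region) :
    DifferentiableOn ℂ (fun v => ∫ u in (0 : ℝ)..1, w u * g (scaleMap u v)) f3Region := by
  intro v₀ hv₀
  have hΙ : uIoc (0 : ℝ) 1 ⊆ Icc 0 1 := by
    rw [uIoc_of_le zero_le_one]; exact Ioc_subset_Icc_self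
  obtain ⟨ε, hε, hball⟩ := Metric.nhds_basis_closedBall.mem_iff.1 (isOpen_f3Region.mem_nhds hv₀)
  have hcs : Continuous fun p : ℝ × (ℂ × ℂ) => scaleMap p.1 p.2 :=
    (continuous_scaleMap.comp continuous_fst).clm_apply continuous_snd
  have hD : ContinuousOn (fun p : ℝ × (ℂ × ℂ) => (fderiv ℂ g (scaleMap p.1 p.2)) ∘L scaleMap p.1)
      (Icc 0 1 ×ˢ f3Region) := by
    refine ContinuousOn.clm_comp ?_ (continuous_scaleMap.comp continuous_fst).continuousOn
    exact (hg.continuousOn_fderiv_of_isOpen isOpen_f3Region le_rfl).comp hcs.continuousOn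
      fun p hp => scaleMap_mem_f3Region hp.1 hp.2
  obtain ⟨C, hC⟩ := ((isCompact_Icc (a := (0 : ℝ)) (b := 1)).prod
    (isCompact_closedBall v₀ ε)).exists_bound_of_continuousOn
      (hD.mono (prod_mono_right hball))
  have hcont : ∀ v ∈ f3Region, ContinuousOn (fun u : ℝ => g (scaleMap u v)) (Icc 0 1) := fun v hv =>
    hg.continuousOn.comp (hcs.comp (by fun_prop : Continuous fun u : ℝ => (u, v))).continuousOn
      fun u hu => scaleMap_mem_f3Region hu hv
  have hwm := (intervalIntegrable_iff.1 hw).aestronglyMeasurable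
  refine (intervalIntegral.hasFDerivAt_integral_of_dominated_of_fderiv_le
    (F := fun v u => w u * g (scaleMap u v))
    (F' := fun v u => w u • ((fderiv ℂ g (scaleMap u v)) ∘L scaleMap u))
    (bound := fun u => ‖w u‖ * C) (Metric.closedBall_mem_nhds v₀ hε)
    ?_ ?_ ?_ ?_ ?_ ?_).differentiableAt.differentiableWithinAt
  · filter_upwards [isOpen_f3Region.mem_nhds hv₀] with v hv
    exact hwm.mul (((hcont v hv).mono hΙ).aestronglyMeasurable measurableSet_uIoc)
  · refine hw.mul_continuousOn ?_
    rw [uIcc_of_le zero_le_one]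
    exact hcont v₀ hv₀
  · refine hwm.smul (ContinuousOn.aestronglyMeasurable ?_ measurableSet_uIoc)
    exact (hD.comp (by fun_prop : Continuous fun u : ℝ => (u, v₀)).continuousOn
      fun u hu => ⟨hu, hv₀⟩).mono hΙ
  · refine .of_forall fun u hu v hv => ?_
    rw [norm_smul]
    gcongr
    exact hC (u, v) ⟨hΙ hu, hv⟩
  · exact hw.norm.mul_const C
  · refine .of_forall fun u hu v hv => ?_
    have hmem := scaleMap_mem_f3Region (hΙ hu) (hball hv)
    have h1 := ((hg.differentiableOn one_ne_zero).differentiableAt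
      (isOpen_f3Region.mem_nhds hmem)).hasFDerivAt
    exact (h1.comp v (scaleMap u).hasFDerivAt).const_mul (w u)

/-- The Euler-type double integral which continues Appell's series with `γ = c₁ + c₂`. -/
def f3Cont (α α' β β' c₁ c₂ : ℂ) (v : ℂ × ℂ) : ℂ :=
  Complex.Gamma (c₁ + c₂) / (Complex.Gamma c₁ * Complex.Gamma c₂) *
    ∫ u in (0 : ℝ)..1, ((u : ℂ) ^ (c₁ - 1) * (1 - (u : ℂ)) ^ (c₂ - 1)) *
      (gaussSeries α β c₁ (u * v.1) * pfaffSeries α' β' c₂ ((1 - u) * v.2))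

theorem differentiableOn_f3Cont (α α' β β' : ℂ) {c₁ c₂ : ℂ} (h₁ : 0 < c₁.re) (h₂ : 0 < c₂.re) :
    DifferentiableOn ℂ (f3Cont α α' β β' c₁ c₂) f3Region := by
  have hg : ContDiffOn ℂ 1 (fun v : ℂ × ℂ => gaussSeries α β c₁ v.1 * pfaffSeries α' β' c₂ v.2)
      f3Region :=
    (((differentiableOn_gaussSeries α β h₁).contDiffOn Metric.isOpen_ball).comp
      contDiff_fst.contDiffOn fun v hv => hv.1).mul
    (((differentiableOn_pfaffSeries α' β' h₂).contDiffOn isOpen_re_lt_half).comp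
      contDiff_snd.contDiffOn fun v hv => hv.2)
  have := (differentiableOn_integral_scaleMap (Complex.betaIntegral_convergent h₁ h₂) hg).const_mul
    (Complex.Gamma (c₁ + c₂) / (Complex.Gamma c₁ * Complex.Gamma c₂))
  simpa only [scaleMap_apply] using! this

/-- Expanding both Gauss series leaves the beta integrals `B(c₁+m, c₂+n)`, which trade `(c₁)_m
(c₂)_n` for `(c₁+c₂)_{m+n}`. Pfaff's identity is available only near the origin, and this suffices
to identify the germ. -/
theorem f3Cont_eq_appellF3Series (α α' β β' : ℂ) {c₁ c₂ : ℂ} (h₁ : 0 < c₁.re) (h₂ : 0 < c₂.re) :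
    ∀ᶠ v in 𝓝 (0 : ℂ × ℂ),
      f3Cont α α' β β' c₁ c₂ v = appellF3Series α α' β β' (c₁ + c₂) v.1 v.2 := by
  obtain ⟨ε, hε, hP⟩ := Metric.eventually_nhds_iff.1 (gaussSeries_pfaff α' β' h₂)
  filter_upwards [Metric.ball_mem_nhds (0 : ℂ × ℂ) (lt_min hε one_pos)] with v hv
  rw [mem_ball_zero_iff, Prod.norm_def, max_lt_iff, lt_min_iff, lt_min_iff] at hv
  obtain ⟨⟨-, hx⟩, ⟨hyε, hy⟩⟩ := hv
  obtain ⟨x, y⟩ := v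
  simp only at hx hyε hy
  let w : ℝ → ℂ := fun u => (u : ℂ) ^ (c₁ - 1) * (1 - (u : ℂ)) ^ (c₂ - 1)
  have hw : IntervalIntegrable w volume 0 1 := Complex.betaIntegral_convergent h₁ h₂
  have hwm := (intervalIntegrable_iff.1 hw).aestronglyMeasurable
  let F : ℕ × ℕ → ℝ → ℂ := fun p u =>
    w u * ((gaussCoeff α β c₁ p.1 * (u * x) ^ p.1) * (gaussCoeff α' β' c₂ p.2 * ((1 - u) * y) ^ p.2))
  have hn : ∀ u ∈ uIoc (0 : ℝ) 1, ‖(u : ℂ)‖ ≤ 1 ∧ ‖1 - (u : ℂ)‖ ≤ 1 := fun u hu => by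
    rw [uIoc_of_le zero_le_one] at hu
    have : (1 - (u : ℂ)) = ((1 - u : ℝ) : ℂ) := by push_cast; rfl
    rw [this, Complex.norm_real, Complex.norm_real, Real.norm_of_nonneg hu.1.le,
      Real.norm_of_nonneg (by linarith [hu.2])]
    exact ⟨hu.2, by linarith [hu.1]⟩
  have hnx : ∀ u ∈ uIoc (0 : ℝ) 1, ‖u * x‖ ≤ ‖x‖ ∧ ‖(1 - u) * y‖ ≤ ‖y‖ := fun u hu => by
    rw [norm_mul, norm_mul]
    exact ⟨mul_le_of_le_one_left (norm_nonneg _) (hn u hu).1,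
      mul_le_of_le_one_left (norm_nonneg _) (hn u hu).2⟩
  have hs1 := summable_norm_gaussSeries α β h₁ hx
  have hs2 := summable_norm_gaussSeries α' β' h₂ hy
  have hs := hs1.mul_of_nonneg hs2 (fun _ => norm_nonneg _) (fun _ => norm_nonneg _)
  have hsum : HasSum (fun p => ∫ u in (0 : ℝ)..1, F p u)
      (∫ u in (0 : ℝ)..1, w u *
        (gaussSeries α β c₁ (u * x) * pfaffSeries α' β' c₂ ((1 - u) * y))) := by
    refine intervalIntegral.hasSum_integral_of_dominated_convergence
      (fun p u => ‖w u‖ * (‖gaussCoeff α β c₁ p.1 * x ^ p.1‖ * ‖gaussCoeff α' β' c₂ p.2 * y ^ p.2‖))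
      (fun p => hwm.mul (Continuous.aestronglyMeasurable (by fun_prop)))
      (fun p => .of_forall fun u hu => ?_)
      (.of_forall fun u hu => hs.mul_left _) ?_ (.of_forall fun u hu => ?_)
    · simp only [F, norm_mul (w u), norm_mul (gaussCoeff α β c₁ p.1),
        norm_mul (gaussCoeff α' β' c₂ p.2), norm_mul (gaussCoeff α β c₁ p.1 * (u * x) ^ p.1),
        norm_pow]
      have := hnx u hu
      gcongr
      · exact this.1
      · exact this.2
    · simp_rw [tsum_mul_left]
      exact hw.norm.mul_const _
    · have hu1 := (hnx u hu).1.trans_lt hx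
      have hu2 := (hnx u hu).2.trans_lt hy
      have e : pfaffSeries α' β' c₂ ((1 - u) * y) = gaussSeries α' β' c₂ ((1 - u) * y) :=
        hP (by simpa using (hnx u hu).2.trans_lt hyε)
      rw [e]
      have hsm := summable_mul_of_summable_norm (summable_norm_gaussSeries α β h₁ hu1)
        (summable_norm_gaussSeries α' β' h₂ hu2)
      have hm := (hasSum_gaussSeries α β h₁ hu1).mul (hasSum_gaussSeries α' β' h₂ hu2) hsm
      exact hm.mul_left (w u)
  rw [f3Cont, appellF3Series, ← (hsum.mul_left _).tsum_eq]
  congr 1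
  ext p
  obtain ⟨m, n⟩ := p
  have hm : 0 < (c₁ + m).re := by simp; linarith [(m.cast_nonneg : (0 : ℝ) ≤ m)]
  have hn' : 0 < (c₂ + n).re := by simp; linarith [(n.cast_nonneg : (0 : ℝ) ≤ n)]
  have hc : 0 < (c₁ + c₂).re := by simp; linarith
  have e1 : ∫ u in (0 : ℝ)..1, F (m, n) u = gaussCoeff α β c₁ m * x ^ m *
      (gaussCoeff α' β' c₂ n * y ^ n) * Complex.betaIntegral (c₁ + m) (c₂ + n) := by
    rw [Complex.betaIntegral, ← intervalIntegral.integral_const_mul]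
    -- Passing to the open interval removes the endpoints, where a complex power of zero does not
    -- split.
    rw [intervalIntegral.integral_of_le zero_le_one, intervalIntegral.integral_of_le zero_le_one,
      integral_Ioc_eq_integral_Ioo, integral_Ioc_eq_integral_Ioo]
    refine setIntegral_congr_fun measurableSet_Ioo fun u hu => ?_
    have u0 : (u : ℂ) ≠ 0 := by exact_mod_cast hu.1.ne'
    have u1 : (1 - u : ℂ) ≠ 0 := by
      rw [sub_ne_zero]; exact_mod_cast hu.2.ne'
    simp only [F, w]
    rw [show c₁ + m - 1 = c₁ - 1 + m by ring, show c₂ + n - 1 = c₂ - 1 + n by ring,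
      Complex.cpow_add _ _ u0, Complex.cpow_add _ _ u1, Complex.cpow_natCast, Complex.cpow_natCast,
      mul_pow, mul_pow]
    ring
  rw [e1, Complex.betaIntegral_eq_Gamma_mul_div _ _ hm hn',
    show c₁ + m + (c₂ + n) = c₁ + c₂ + ((m + n : ℕ) : ℂ) by push_cast; ring,
    ← poch_mul_Gamma (ne_neg_natCast_of_re_pos h₁), ← poch_mul_Gamma (ne_neg_natCast_of_re_pos h₂),
    ← poch_mul_Gamma (ne_neg_natCast_of_re_pos hc)]
  have g1 := Complex.Gamma_ne_zero_of_re_pos h₁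
  have g2 := Complex.Gamma_ne_zero_of_re_pos h₂
  have g3 := Complex.Gamma_ne_zero_of_re_pos hc
  have g4 := poch_ne_zero (ne_neg_natCast_of_re_pos h₁) m
  have g5 := poch_ne_zero (ne_neg_natCast_of_re_pos h₂) n
  have g6 := poch_ne_zero (ne_neg_natCast_of_re_pos hc) (m + n)
  have g7 : (m.factorial : ℂ) ≠ 0 := by exact_mod_cast m.factorial_ne_zero
  have g8 : (n.factorial : ℂ) ≠ 0 := by exact_mod_cast n.factorial_ne_zero
  simp only [gaussCoeff]
  generalize x ^ m = X
  generalize y ^ n = Y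
  clear * - g1 g2 g3 g4 g5 g6 g7 g8
  field_simp

/-- By uniqueness of the continuation, every splitting of `γ` into two parts with positive real part
gives the same value. -/
theorem appellF3_eq_f3Cont (α α' β β' : ℂ) {c₁ c₂ : ℂ} (h₁ : 0 < c₁.re) (h₂ : 0 < c₂.re)
    {x y : ℂ} (hxy : (x, y) ∈ f3Region) :
    appellF3 α α' β β' (c₁ + c₂) x y = f3Cont α α' β β' c₁ c₂ (x, y) :=
  IsAppellF3Value.appellF3_eq ⟨f3Region, f3Cont α α' β β' c₁ c₂, isOpen_f3Region,
    starConvex_f3Region, hxy, differentiableOn_f3Cont α α' β β' h₁ h₂,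
    f3Cont_eq_appellF3Series α α' β β' h₁ h₂, rfl⟩

theorem continuousOn_appellF3 (α α' β β' : ℂ) {γ : ℂ} (hγ : 0 < γ.re) :
    ContinuousOn (fun v : ℂ × ℂ => appellF3 α α' β β' γ v.1 v.2) f3Region := by
  have h : 0 < (γ / 2).re := by simpa using hγ
  refine (differentiableOn_f3Cont α α' β β' h h).continuousOn.congr fun v hv => ?_
  have := appellF3_eq_f3Cont α α' β β' h h (x := v.1) (y := v.2) hv
  rwa [add_halves] at this

theorem appellF3_zero (α α' β β' : ℂ) {γ : ℂ} (hγ : 0 < γ.re) : appellF3 α α' β β' γ 0 0 = 1 := by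
  have h : 0 < (γ / 2).re := by simpa using hγ
  have h1 := appellF3_eq_f3Cont α α' β β' h h (x := 0) (y := 0) zero_mem_f3Region
  have h2 := (f3Cont_eq_appellF3Series α α' β β' h h).self_of_nhds
  rw [add_halves] at h1 h2
  rw [h1]
  refine h2.trans ?_
  rw [appellF3Series, tsum_eq_single (0, 0)]
  · simp
  · rintro ⟨m, n⟩ hmn
    have : m ≠ 0 ∨ n ≠ 0 := by
      by_contra! hcon
      exact hmn (by rw [hcon.1, hcon.2])
    rcases this with h | h <;> simp [h]

/-! ### The Saigo–Maeda kernel in exponential coordinates -/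

/-- The kernel `(1 - e^{-u})^{γ-1} F₃(α, α', β, β', γ; 1 - e^{-u}, 1 - e^u)`. -/
def f3Kernel (α α' β β' γ : ℂ) (u : ℝ) : ℂ :=
  (oneSubExp u : ℂ) ^ (γ - 1) * appellF3 α α' β β' γ (oneSubExp u) ((1 - Real.exp u : ℝ) : ℂ)

theorem f3Kernel_args_mem {u : ℝ} (hu : 0 ≤ u) :
    ((oneSubExp u : ℂ), ((1 - Real.exp u : ℝ) : ℂ)) ∈ f3Region := by
  refine ⟨?_, ?_⟩
  · rcases hu.eq_or_lt with rfl | hu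
    · simp [oneSubExp]
    · simpa using norm_oneSubExp_lt_one hu
  · have := Real.one_le_exp hu
    simp only [mem_ofPred_eq, Complex.ofReal_re]
    linarith

theorem continuousOn_appellF3_exp (α α' β β' : ℂ) {γ : ℂ} (hγ : 0 < γ.re) :
    ContinuousOn (fun u : ℝ => appellF3 α α' β β' γ (oneSubExp u) ((1 - Real.exp u : ℝ) : ℂ))
      (Ici 0) := by
  have hc : Continuous fun u : ℝ => ((oneSubExp u : ℂ), ((1 - Real.exp u : ℝ) : ℂ)) :=
    (Complex.continuous_ofReal.comp continuous_oneSubExp).prodMk (by fun_prop)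
  exact (continuousOn_appellF3 α α' β β' hγ).comp hc.continuousOn fun u hu => f3Kernel_args_mem hu

theorem continuousOn_f3Kernel (α α' β β' : ℂ) {γ : ℂ} (hγ : 0 < γ.re) :
    ContinuousOn (f3Kernel α α' β β' γ) (Ioi 0) :=
  (continuousOn_oneSubExp_cpow (γ - 1)).mul
    ((continuousOn_appellF3_exp α α' β β' hγ).mono Ioi_subset_Ici_self)

/-- At `y = 1 - e^q` one has `y/(y-1) = 1 - e^{-q}`: Pfaff's transformation brings the second Gauss
factor to the same kind of argument as the first. -/
theorem pfaffSeries_one_sub_exp (a b c : ℂ) (q : ℝ) :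
    pfaffSeries a b c ((1 - Real.exp q : ℝ) : ℂ)
      = Complex.exp (-(a * q)) * gaussSeries a (c - b) c (oneSubExp q) := by
  rw [pfaffSeries]
  have h : ((Real.exp q : ℝ) : ℂ) ≠ 0 := by exact_mod_cast (Real.exp_pos q).ne'
  congr 1
  · push_cast
    rw [sub_sub_cancel, ← Complex.ofReal_exp, ofReal_exp_cpow, neg_mul]
  · congr 1
    rw [oneSubExp, Real.exp_neg]
    push_cast at h ⊢
    rw [sub_sub_cancel_left]
    field_simp
    ring

theorem strictMono_oneSubExp : StrictMono oneSubExp := fun u v h => by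
  simp only [oneSubExp]
  linarith [Real.exp_lt_exp.2 (neg_lt_neg h)]

theorem image_oneSubExp_div {u : ℝ} (hu : 0 < u) :
    (fun r => oneSubExp r / oneSubExp u) '' Ioo 0 u = Ioo 0 1 := by
  have hX := oneSubExp_pos hu
  ext t
  constructor
  · rintro ⟨r, hr, rfl⟩
    exact ⟨div_pos (oneSubExp_pos hr.1) hX, (div_lt_one hX).2 (strictMono_oneSubExp hr.2)⟩
  · rintro ⟨h0, h1⟩
    have hp : 0 < t * oneSubExp u := mul_pos h0 hX
    have hlt : t * oneSubExp u < oneSubExp u := by nlinarith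
    have hl := oneSubExp_lt_one u
    have he : oneSubExp (-Real.log (1 - t * oneSubExp u)) = t * oneSubExp u := by
      rw [oneSubExp, neg_neg, Real.exp_log (by linarith)]; ring
    refine ⟨-Real.log (1 - t * oneSubExp u), ⟨?_, ?_⟩, ?_⟩
    · have := Real.log_neg (x := 1 - t * oneSubExp u) (by linarith) (by linarith)
      linarith
    · rw [← strictMono_oneSubExp.lt_iff_lt, he]; exact hlt
    · simp only [he]
      field_simp

/-- This is what turns Euler's integral into a convolution: if the Euler variable corresponds to
`r`, its complement is governed by `u - r`. -/
theorem one_sub_oneSubExp_div {u r : ℝ} (hu : 0 < u) :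
    1 - oneSubExp r / oneSubExp u = Real.exp (-r) * oneSubExp (u - r) / oneSubExp u := by
  have hX := (oneSubExp_pos hu).ne'
  have : Real.exp (-r) * Real.exp (-(u - r)) = Real.exp (-u) := by rw [← Real.exp_add]; ring_nf
  rw [eq_div_iff hX, sub_mul, one_mul, div_mul_cancel₀ _ hX]
  simp only [oneSubExp]
  linear_combination this

/-- The kernel is a convolution of two hypergeometric kernels. -/
theorem f3Kernel_eq_convolution (α α' β β' : ℂ) {c₁ c₂ : ℂ} (h₁ : 0 < c₁.re) (h₂ : 0 < c₂.re)
    {u : ℝ} (hu : 0 < u) :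
    f3Kernel α α' β β' (c₁ + c₂) u
      = Complex.Gamma (c₁ + c₂) / (Complex.Gamma c₁ * Complex.Gamma c₂) *
        ∫ r in (0 : ℝ)..u,
          (Complex.exp (-(c₂ * r)) * ((oneSubExp r : ℂ) ^ (c₁ - 1) * gaussSeries α β c₁ (oneSubExp r))) *
          (Complex.exp (-(α' * (u - r : ℝ))) * ((oneSubExp (u - r) : ℂ) ^ (c₂ - 1) *
            gaussSeries α' (c₂ - β') c₂ (oneSubExp (u - r)))) := by
  have hX := oneSubExp_pos hu
  have hder : ∀ r ∈ Ioo 0 u, HasDerivWithinAt (fun r => oneSubExp r / oneSubExp u)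
      (Real.exp (-r) / oneSubExp u) (Ioo 0 u) r := fun r _ => by
    have := ((hasDerivWithinAt_exp_neg r (Ioo 0 u)).const_sub 1).div_const (oneSubExp u)
    rwa [neg_neg] at this
  have hinj : InjOn (fun r => oneSubExp r / oneSubExp u) (Ioo 0 u) := fun r _ r' _ h => by
    have h' := (div_left_inj' hX.ne').1 h
    exact strictMono_oneSubExp.injective h'
  rw [f3Kernel, appellF3_eq_f3Cont α α' β β' h₁ h₂ (f3Kernel_args_mem hu.le), f3Cont, mul_left_comm]
  congr 1
  rw [intervalIntegral.integral_of_le zero_le_one, integral_Ioc_eq_integral_Ioo,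
    ← image_oneSubExp_div hu, integral_image_eq_integral_abs_deriv_smul measurableSet_Ioo hder hinj,
    intervalIntegral.integral_of_le hu.le, integral_Ioc_eq_integral_Ioo, ← integral_const_mul]
  refine setIntegral_congr_fun measurableSet_Ioo fun r hr => ?_
  have hA := oneSubExp_pos hr.1
  have hB := oneSubExp_pos (sub_pos.2 hr.2)
  have hX' : (oneSubExp u : ℂ) ≠ 0 := by exact_mod_cast hX.ne'
  have e0 : (1 : ℂ) - ((oneSubExp r / oneSubExp u : ℝ) : ℂ)
      = ((Real.exp (-r) * oneSubExp (u - r) / oneSubExp u : ℝ) : ℂ) := by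
    rw [← one_sub_oneSubExp_div hu]; push_cast; rfl
  have e1 : ((oneSubExp r / oneSubExp u : ℝ) : ℂ) * (oneSubExp u : ℂ) = oneSubExp r := by
    push_cast; field_simp
  have e2 : ((Real.exp (-r) * oneSubExp (u - r) / oneSubExp u : ℝ) : ℂ) * ((1 - Real.exp u : ℝ) : ℂ)
      = ((1 - Real.exp (u - r) : ℝ) : ℂ) := by
    rw [← Complex.ofReal_mul]
    congr 1
    have hx2 : 1 - Real.exp u = - (Real.exp u * oneSubExp u) := by
      rw [oneSubExp, mul_sub, ← Real.exp_add]; simp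
    rw [hx2]
    have hx3 : Real.exp (-r) * Real.exp u * oneSubExp (u - r) = Real.exp (u - r) - 1 := by
      rw [← Real.exp_add, oneSubExp, mul_sub, ← Real.exp_add]
      ring_nf
      simp only [Real.exp_zero]
      ring
    field_simp
    linear_combination -hx3
  -- The exponents of `1 - e^{-u}` add up to zero, and those of `e^{-r}` to `1 + (c₂ - 1) = c₂`.
  have e3 : (oneSubExp u : ℂ) ^ (c₁ + c₂ - 1) * (((Real.exp (-r) / oneSubExp u : ℝ) : ℂ) *
      (((oneSubExp r / oneSubExp u : ℝ) : ℂ) ^ (c₁ - 1) *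
      ((Real.exp (-r) * oneSubExp (u - r) / oneSubExp u : ℝ) : ℂ) ^ (c₂ - 1)))
      = Complex.exp (-(c₂ * r)) * (oneSubExp r : ℂ) ^ (c₁ - 1) * (oneSubExp (u - r) : ℂ) ^ (c₂ - 1) := by
    have hE := Real.exp_pos (-r)
    have e4 : ((Real.exp (-r) / oneSubExp u : ℝ) : ℂ)
        = ((Real.exp (-r) / oneSubExp u : ℝ) : ℂ) ^ (1 : ℂ) := by simp
    rw [e4, ofReal_cpow_eq_exp hX, ofReal_cpow_eq_exp hA, ofReal_cpow_eq_exp hB,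
      ofReal_cpow_eq_exp (div_pos hE hX), ofReal_cpow_eq_exp (div_pos hA hX),
      ofReal_cpow_eq_exp (div_pos (mul_pos hE hB) hX),
      Real.log_div hE.ne' hX.ne', Real.log_div hA.ne' hX.ne', Real.log_div (mul_pos hE hB).ne' hX.ne',
      Real.log_mul hE.ne' hB.ne', Real.log_exp]
    simp only [← Complex.exp_add]
    congr 1
    push_cast
    ring
  simp only []
  rw [abs_of_pos (div_pos (Real.exp_pos _) hX), Complex.real_smul, e0, e1, e2,
    pfaffSeries_one_sub_exp]
  linear_combination (gaussSeries α β c₁ (oneSubExp r) * (Complex.exp (-(α' * (u - r : ℝ))) *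
    gaussSeries α' (c₂ - β') c₂ (oneSubExp (u - r)))) * e3

/-- The Laplace transform of the kernel. -/
def f3Symbol (α α' β β' γ s : ℂ) : ℂ :=
  Complex.Gamma γ * (Complex.Gamma (s + α') * Complex.Gamma (s + β') * Complex.Gamma (s + γ - α - β))
    / (Complex.Gamma (s + γ - α) * Complex.Gamma (s + α' + β') * Complex.Gamma (s + γ - β))

/-- The convolution, with both parts equal to `γ/2`, becomes a product of transforms at `s + γ/2`
and `s + α'`. The factor `Γ(s + γ/2)` cancels between them, so no trace of the splitting remains. -/
theorem exists_laplace_f3Kernel (α α' β β' : ℂ) {γ : ℂ} (hγ : 0 < γ.re) :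
    ∃ S : ℝ, ∀ s : ℂ, S < s.re →
      IntegrableOn (fun u : ℝ => Complex.exp (-(s * u)) * f3Kernel α α' β β' γ u) (Ioi 0) ∧
      ∫ u : ℝ in Ioi 0, Complex.exp (-(s * u)) * f3Kernel α α' β β' γ u
        = f3Symbol α α' β β' γ s := by
  have h : 0 < (γ / 2).re := by simpa using hγ
  obtain ⟨c, rfl⟩ : ∃ c, γ = c + c := ⟨γ / 2, (add_halves γ).symm⟩
  rw [add_self_div_two] at h
  obtain ⟨S₁, hS₁⟩ := exists_laplace_gaussSeries α β h
  obtain ⟨S₂, hS₂⟩ := exists_laplace_gaussSeries α' (c - β') h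
  refine ⟨max (max (S₁ - c.re) (S₂ - α'.re)) (-c.re), fun s hs => ?_⟩
  rw [max_lt_iff, max_lt_iff] at hs
  obtain ⟨hi₁, he₁⟩ := hS₁ (s + c) (by simp; linarith)
  obtain ⟨hi₂, he₂⟩ := hS₂ (s + α') (by simp; linarith)
  set f : ℝ → ℂ := fun r => Complex.exp (-((s + c) * r)) *
    ((oneSubExp r : ℂ) ^ (c - 1) * gaussSeries α β c (oneSubExp r)) with hf
  set g : ℝ → ℂ := fun r => Complex.exp (-((s + α') * r)) *
    ((oneSubExp r : ℂ) ^ (c - 1) * gaussSeries α' (c - β') c (oneSubExp r)) with hg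
  set C : ℂ := Complex.Gamma (c + c) / (Complex.Gamma c * Complex.Gamma c) with hC
  have key : ∀ u ∈ Ioi (0 : ℝ), Complex.exp (-(s * u)) * f3Kernel α α' β β' (c + c) u
      = C * ∫ r in (0 : ℝ)..u, ContinuousLinearMap.mul ℝ ℂ (f r) (g (u - r)) := by
    intro u hu
    rw [f3Kernel_eq_convolution α α' β β' h h hu, mul_left_comm, ← intervalIntegral.integral_const_mul]
    congr 2
    ext r
    simp only [hf, hg, ContinuousLinearMap.mul_apply']
    have e : Complex.exp (-((s + c) * r)) * Complex.exp (-((s + α') * (u - r : ℝ)))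
        = Complex.exp (-(s * u)) * (Complex.exp (-(c * r)) * Complex.exp (-(α' * (u - r : ℝ)))) := by
      simp only [← Complex.exp_add]
      congr 1
      push_cast
      ring
    linear_combination (-(((oneSubExp r : ℂ) ^ (c - 1) * gaussSeries α β c (oneSubExp r)) *
      ((oneSubExp (u - r) : ℂ) ^ (c - 1) * gaussSeries α' (c - β') c (oneSubExp (u - r))))) * e
  refine ⟨?_, ?_⟩
  · have hp := (integrable_posConvolution hi₁ hi₂ (ContinuousLinearMap.mul ℝ ℂ)).const_mul C
    refine (hp.integrableOn (s := Ioi 0)).congr_fun (fun u hu => ?_) measurableSet_Ioi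
    simp only [posConvolution, indicator_of_mem hu, key u hu]
  · rw [setIntegral_congr_fun measurableSet_Ioi key, integral_const_mul,
      integral_posConvolution hi₁ hi₂, ContinuousLinearMap.mul_apply', he₁, he₂, hC, f3Symbol]
    have g1 := Complex.Gamma_ne_zero_of_re_pos h
    have g2 := Complex.Gamma_ne_zero_of_re_pos (s := s + c) (by simp; linarith)
    rw [show s + c + c - α - β = s + (c + c) - α - β by ring,
      show s + c + c - α = s + (c + c) - α by ring, show s + c + c - β = s + (c + c) - β by ring,
      show s + α' + c - α' - (c - β') = s + β' by ring, show s + α' + c - α' = s + c by ring,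
      show s + α' + c - (c - β') = s + α' + β' by ring]
    field_simp

/-! ### Laplace transforms: continuation, behaviour far to the right, and termwise integration -/

theorem integrableOn_exp_mul_of_re_le {κ : ℝ → ℂ} (hκ : ContinuousOn κ (Ioi 0)) {s₀ s : ℂ}
    (h : IntegrableOn (fun u : ℝ => Complex.exp (-(s₀ * u)) * κ u) (Ioi 0)) (hs : s₀.re ≤ s.re) :
    IntegrableOn (fun u : ℝ => Complex.exp (-(s * u)) * κ u) (Ioi 0) := by
  refine h.norm.mono' (ContinuousOn.aestronglyMeasurable
    ((by fun_prop : Continuous fun u : ℝ => Complex.exp (-(s * u))).continuousOn.mul hκ)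
    measurableSet_Ioi) ?_
  filter_upwards [ae_restrict_mem measurableSet_Ioi] with u hu
  rw [norm_mul, norm_mul, Complex.norm_exp, Complex.norm_exp]
  refine mul_le_mul_of_nonneg_right (Real.exp_le_exp.2 ?_) (norm_nonneg _)
  have : 0 < u := hu
  simp only [Complex.neg_re, Complex.re_mul_ofReal]
  nlinarith

theorem differentiableAt_laplace {κ : ℝ → ℂ} (hκ : ContinuousOn κ (Ioi 0)) {s₀ s : ℂ}
    (h : IntegrableOn (fun u : ℝ => Complex.exp (-(s₀ * u)) * κ u) (Ioi 0)) (hs : s₀.re < s.re) :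
    DifferentiableAt ℂ (fun s : ℂ => ∫ u : ℝ in Ioi 0, Complex.exp (-(s * u)) * κ u) s := by
  set ε := (s.re - s₀.re) / 2 with hε
  have hε0 : 0 < ε := by rw [hε]; linarith
  have hU : {w : ℂ | s₀.re + ε < w.re} ∈ 𝓝 s :=
    (isOpen_lt continuous_const Complex.continuous_re).mem_nhds (by simp [hε]; linarith)
  refine (hasDerivAt_integral_of_dominated_loc_of_deriv_le (μ := volume.restrict (Ioi (0 : ℝ)))
    (F := fun (s : ℂ) (u : ℝ) => Complex.exp (-(s * u)) * κ u)
    (F' := fun (s : ℂ) (u : ℝ) => Complex.exp (-(s * u)) * (-u) * κ u)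
    (bound := fun u => ε⁻¹ * ‖Complex.exp (-(s₀ * u)) * κ u‖) hU ?_ ?_ ?_ ?_ ?_ ?_).2.differentiableAt
  · exact .of_forall fun w => ContinuousOn.aestronglyMeasurable
      ((by fun_prop : Continuous fun u : ℝ => Complex.exp (-(w * u))).continuousOn.mul hκ)
      measurableSet_Ioi
  · exact integrableOn_exp_mul_of_re_le hκ h hs.le
  · exact ContinuousOn.aestronglyMeasurable
      ((by fun_prop : Continuous fun u : ℝ => Complex.exp (-(s * u)) * (-u)).continuousOn.mul hκ)
      measurableSet_Ioi
  · filter_upwards [ae_restrict_mem measurableSet_Ioi] with u hu w hw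
    have hu0 : 0 < u := hu
    have hw' : s₀.re + ε < w.re := hw
    rw [norm_mul, norm_mul, norm_mul, Complex.norm_exp, Complex.norm_exp, norm_neg,
      Complex.norm_real, Real.norm_of_nonneg hu0.le, ← mul_assoc]
    refine mul_le_mul_of_nonneg_right ?_ (norm_nonneg _)
    simp only [Complex.neg_re, Complex.re_mul_ofReal]
    -- The factor `u` produced by differentiation is absorbed by `e^{εu}`, with `ε` half the gap
    -- between `s` and `s₀`.
    have h1 : u ≤ ε⁻¹ * Real.exp (ε * u) := by
      have := Real.add_one_le_exp (ε * u)
      rw [inv_mul_eq_div, le_div_iff₀ hε0]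
      linarith
    calc Real.exp (-(w.re * u)) * u ≤ Real.exp (-(s₀.re * u) - ε * u) * (ε⁻¹ * Real.exp (ε * u)) := by
          gcongr
          nlinarith
      _ = ε⁻¹ * Real.exp (-(s₀.re * u)) := by
          rw [Real.exp_sub]
          have := (Real.exp_pos (ε * u)).ne'
          field_simp
  · exact h.norm.const_mul _
  · refine .of_forall fun u w _ => ?_
    have h1 : HasDerivAt (fun w : ℂ => -(w * (u : ℂ))) (-u) w := by
      simpa using! ((hasDerivAt_id w).mul_const (u : ℂ)).neg
    exact h1.cexp.mul_const (κ u)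

/-- Holomorphy is available only strictly to the right of a point of integrability; this one-sided
limit recovers the value at the point itself, which may lie on the abscissa of convergence. -/
theorem tendsto_laplace_right {κ : ℝ → ℂ} (hκ : ContinuousOn κ (Ioi 0)) {s : ℂ}
    (h : IntegrableOn (fun u : ℝ => Complex.exp (-(s * u)) * κ u) (Ioi 0)) :
    Tendsto (fun ε : ℝ => ∫ u : ℝ in Ioi 0, Complex.exp (-((s + ε) * u)) * κ u) (𝓝[>] 0)
      (𝓝 (∫ u : ℝ in Ioi 0, Complex.exp (-(s * u)) * κ u)) := by
  refine tendsto_integral_filter_of_dominated_convergence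
    (fun u => ‖Complex.exp (-(s * u)) * κ u‖) ?_ ?_ h.norm ?_
  · exact .of_forall fun ε => ContinuousOn.aestronglyMeasurable
      ((by fun_prop : Continuous fun u : ℝ => Complex.exp (-((s + ε) * u))).continuousOn.mul hκ)
      measurableSet_Ioi
  · filter_upwards [self_mem_nhdsWithin] with ε hε
    filter_upwards [ae_restrict_mem measurableSet_Ioi] with u hu
    rw [norm_mul, norm_mul, Complex.norm_exp, Complex.norm_exp]
    refine mul_le_mul_of_nonneg_right (Real.exp_le_exp.2 ?_) (norm_nonneg _)
    have h1 : 0 < u := hu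
    have h2 : 0 < ε := hε
    simp only [Complex.neg_re, Complex.re_mul_ofReal, Complex.add_re, Complex.ofReal_re]
    nlinarith
  · refine .of_forall fun u => ?_
    have : Continuous fun ε : ℝ => Complex.exp (-((s + ε) * u)) * κ u := by fun_prop
    have := this.tendsto 0
    simp only [Complex.ofReal_zero, add_zero] at this
    exact this.mono_left nhdsWithin_le_nhds

/-- An identity `L(s) D(s) = N(s)` between a Laplace transform and entire functions extends from a
right half-plane to the whole region of absolute convergence. -/
theorem laplace_mul_eq_of_eventually {κ : ℝ → ℂ} (hκ : ContinuousOn κ (Ioi 0)) {D N : ℂ → ℂ}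
    (hD : Differentiable ℂ D) (hN : Differentiable ℂ N) {S : ℝ}
    (hS : ∀ s : ℂ, S < s.re → (∫ u : ℝ in Ioi 0, Complex.exp (-(s * u)) * κ u) * D s = N s) {s : ℂ}
    (h : IntegrableOn (fun u : ℝ => Complex.exp (-(s * u)) * κ u) (Ioi 0)) :
    (∫ u : ℝ in Ioi 0, Complex.exp (-(s * u)) * κ u) * D s = N s := by
  set U : Set ℂ := {w | s.re < w.re} with hU
  have hUo : IsOpen U := isOpen_lt continuous_const Complex.continuous_re
  have hUc : IsPreconnected U := (convex_halfSpace_re_gt s.re).isPreconnected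
  have hL : DifferentiableOn ℂ
      (fun s => (∫ u : ℝ in Ioi 0, Complex.exp (-(s * u)) * κ u) * D s) U := fun w hw =>
    ((differentiableAt_laplace hκ h hw).mul (hD w)).differentiableWithinAt
  set w₀ : ℂ := ((max S s.re + 1 : ℝ) : ℂ) with hw₀
  have hw₀re : w₀.re = max S s.re + 1 := by rw [hw₀, Complex.ofReal_re]
  have hm1 := le_max_left S s.re
  have hm2 := le_max_right S s.re
  -- Identity theorem on the half-plane to the right of `s`; the base point `w₀` also lies beyond
  -- `S`, where the identity is known.
  have heq : EqOn (fun s => (∫ u : ℝ in Ioi 0, Complex.exp (-(s * u)) * κ u) * D s) N U := by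
    refine (hL.analyticOnNhd hUo).eqOn_of_preconnected_of_eventuallyEq
      (hN.differentiableOn.analyticOnNhd hUo) hUc
      (show s.re < w₀.re by rw [hw₀re]; linarith) ?_
    filter_upwards [(isOpen_lt continuous_const Complex.continuous_re).mem_nhds
      (show S < w₀.re by rw [hw₀re]; linarith)] with w hw using hS w hw
  have hsub : Tendsto (fun ε : ℝ => s + (ε : ℂ)) (𝓝[>] 0) (𝓝 s) := by
    have : Continuous fun ε : ℝ => s + (ε : ℂ) := by fun_prop
    have := this.tendsto 0
    simp only [Complex.ofReal_zero, add_zero] at this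
    exact this.mono_left nhdsWithin_le_nhds
  have h1 := (tendsto_laplace_right hκ h).mul ((hD.continuous.tendsto s).comp hsub)
  have h2 := (hN.continuous.tendsto s).comp hsub
  refine tendsto_nhds_unique (h1.congr' ?_) h2
  filter_upwards [self_mem_nhdsWithin] with ε hε
  have : 0 < ε := hε
  exact heq (show s.re < (s + ε).re by simpa using this)

/-! ### Watson-type comparison of Laplace integrals. -/

theorem integrableOn_rpow_mul_exp_neg_Ioi {g l : ℝ} (hg : 0 < g) (hl : 0 < l) :
    IntegrableOn (fun u : ℝ => u ^ (g - 1) * Real.exp (-(l * u))) (Ioi 0) :=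
  .of_integral_ne_zero (by
    rw [Real.integral_rpow_mul_exp_neg_mul_Ioi hg hl]
    have := Real.Gamma_pos_of_pos hg
    positivity)

theorem norm_ofReal_exp_mul (x : ℝ) (z : ℂ) : ‖((Real.exp x : ℝ) : ℂ) * z‖ = Real.exp x * ‖z‖ := by
  rw [norm_mul, Complex.norm_real, Real.norm_of_nonneg (Real.exp_pos x).le]

/-- A lower bound of Watson's type: far to the right, a Laplace integral whose integrand behaves
like `u^{γ-1}` at `0` is comparable with the integral of the absolute value. -/
theorem exists_integral_norm_le_mul_norm_laplace {κ : ℝ → ℂ} (hκ : ContinuousOn κ (Ioi 0)) {γ : ℂ}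
    (hγ : 0 < γ.re) (h0 : Tendsto (fun u : ℝ => κ u / (u : ℂ) ^ (γ - 1)) (𝓝[>] 0) (𝓝 1)) {l₀ : ℝ}
    (hi : IntegrableOn (fun u : ℝ => ((Real.exp (-(l₀ * u)) : ℝ) : ℂ) * κ u) (Ioi 0)) :
    ∃ C : ℝ, ∀ᶠ l : ℝ in atTop,
      ∫ u : ℝ in Ioi 0, ‖((Real.exp (-(l * u)) : ℝ) : ℂ) * κ u‖
        ≤ C * ‖∫ u : ℝ in Ioi 0, ((Real.exp (-(l * u)) : ℝ) : ℂ) * κ u‖ := by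
  set g := γ.re with hg
  have hGg : 0 < Real.Gamma g := Real.Gamma_pos_of_pos hγ
  have hGγ : 0 < ‖Complex.Gamma γ‖ := norm_pos_iff.2 (Complex.Gamma_ne_zero_of_re_pos hγ)
  have hmono : ∀ l, l₀ ≤ l →
      IntegrableOn (fun u : ℝ => ((Real.exp (-(l * u)) : ℝ) : ℂ) * κ u) (Ioi 0) := fun l hl => by
    have := integrableOn_exp_mul_of_re_le (s₀ := (l₀ : ℂ)) (s := (l : ℂ)) hκ (by simpa using hi)
      (by simpa using hl)
    simpa using this
  set l₁ := max l₀ 1 with hl₁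
  have hl₁0 : 0 < l₁ := lt_of_lt_of_le one_pos (le_max_right _ _)
  have hi₁ := hmono l₁ (le_max_left _ _)
  -- The error near `0` and the tail will each be at most `ε Γ(g) l^{-g}`, a quarter of the main
  -- term `|Γ(γ)| l^{-g}`; half of it survives as a lower bound.
  set ε : ℝ := ‖Complex.Gamma γ‖ / (4 * Real.Gamma g) with hε
  have hε0 : 0 < ε := by positivity
  have hpow : ∀ u : ℝ, 0 < u → ‖(u : ℂ) ^ (γ - 1)‖ = u ^ (g - 1) := fun u hu => by
    rw [Complex.norm_cpow_eq_rpow_re_of_pos hu]; simp [hg]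
  have hnear : ∃ δ > 0, ∀ u, 0 < u → u < δ → ‖κ u - (u : ℂ) ^ (γ - 1)‖ ≤ ε * u ^ (g - 1) := by
    obtain ⟨δ, hδ, h⟩ := Metric.tendsto_nhdsWithin_nhds.1 h0 ε hε0
    refine ⟨δ, hδ, fun u hu huδ => ?_⟩
    have h1 := (h hu (by simpa [abs_of_pos hu] using huδ)).le
    have hne : (u : ℂ) ^ (γ - 1) ≠ 0 := by
      rw [← norm_ne_zero_iff, hpow u hu]; positivity
    rw [dist_eq_norm, div_sub_one hne, norm_div, hpow u hu, div_le_iff₀ (by positivity)] at h1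
    exact h1
  obtain ⟨δ, hδ, hnear⟩ := hnear
  -- An integrable majorant at the fixed rate `l₁`. For `u ≥ δ` and `l ≥ l₁` the surplus decay gives
  -- the extra factor `e^{-(l-l₁)δ}`.
  set R : ℝ → ℝ := fun u => Real.exp (-(l₁ * u)) * ‖κ u‖ + u ^ (g - 1) * Real.exp (-(l₁ * u)) with hR
  have hRi : IntegrableOn R (Ioi 0) :=
    Integrable.add (hi₁.norm.congr (.of_forall fun u => norm_ofReal_exp_mul _ _))
      (integrableOn_rpow_mul_exp_neg_Ioi hγ hl₁0)
  set M := ∫ u in Ioi 0, R u with hM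
  have hpw : ∀ l, l₁ ≤ l → ∀ u ∈ Ioi (0 : ℝ),
      ‖((Real.exp (-(l * u)) : ℝ) : ℂ) * (κ u - (u : ℂ) ^ (γ - 1))‖
        ≤ ε * (u ^ (g - 1) * Real.exp (-(l * u))) + Real.exp (-((l - l₁) * δ)) * R u := by
    intro l hl u hu
    have hu0 : 0 < u := hu
    have hup := Real.rpow_pos_of_pos hu0 (g - 1)
    have hR0 : 0 ≤ R u := by simp only [hR]; positivity
    rw [norm_ofReal_exp_mul]
    rcases lt_or_ge u δ with h | h
    · have := mul_le_mul_of_nonneg_left (hnear u hu0 h) (Real.exp_pos (-(l * u))).le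
      have h2 : 0 ≤ Real.exp (-((l - l₁) * δ)) * R u := by positivity
      linarith
    · have h1 : ‖κ u - (u : ℂ) ^ (γ - 1)‖ ≤ ‖κ u‖ + u ^ (g - 1) := by
        rw [← hpow u hu0]; exact norm_sub_le _ _
      have h2 : Real.exp (-(l * u)) ≤ Real.exp (-((l - l₁) * δ)) * Real.exp (-(l₁ * u)) := by
        rw [← Real.exp_add]
        apply Real.exp_le_exp.2
        nlinarith
      calc Real.exp (-(l * u)) * ‖κ u - (u : ℂ) ^ (γ - 1)‖
          ≤ (Real.exp (-((l - l₁) * δ)) * Real.exp (-(l₁ * u))) * (‖κ u‖ + u ^ (g - 1)) := by gcongr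
        _ = Real.exp (-((l - l₁) * δ)) * R u := by simp only [hR]; ring
        _ ≤ _ := le_add_of_nonneg_left (by positivity)
  have htail : ∀ᶠ l : ℝ in atTop,
      Real.exp (-((l - l₁) * δ)) * M ≤ ε * ((1 / l) ^ g * Real.Gamma g) := by
    have h1 : Tendsto (fun l : ℝ => (Real.exp (l₁ * δ) * M) * (l ^ g * Real.exp (-δ * l))) atTop
        (𝓝 ((Real.exp (l₁ * δ) * M) * 0)) :=
      (tendsto_rpow_mul_exp_neg_mul_atTop_nhds_zero g δ hδ).const_mul _
    rw [mul_zero] at h1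
    filter_upwards [h1.eventually_le_const (show (0 : ℝ) < ε * Real.Gamma g by positivity),
      eventually_gt_atTop 0] with l hl hl0
    have hlg := Real.rpow_pos_of_pos hl0 g
    rw [one_div, Real.inv_rpow hl0.le]
    have e : Real.exp (-((l - l₁) * δ)) = Real.exp (l₁ * δ) * Real.exp (-δ * l) := by
      rw [← Real.exp_add]; ring_nf
    rw [e]
    calc Real.exp (l₁ * δ) * Real.exp (-δ * l) * M
        = ((Real.exp (l₁ * δ) * M) * (l ^ g * Real.exp (-δ * l))) * (l ^ g)⁻¹ := by
          field_simp
      _ ≤ (ε * Real.Gamma g) * (l ^ g)⁻¹ := by gcongr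
      _ = _ := by ring
  -- The ratio of the upper bound for the integral of the norm to the lower bound for the norm of
  -- the integral, both measured in units of `l^{-g}`.
  refine ⟨(Real.Gamma g + ‖Complex.Gamma γ‖ / 2) / (‖Complex.Gamma γ‖ / 2), ?_⟩
  filter_upwards [htail, eventually_ge_atTop l₁] with l hl hl1
  have hl0 : 0 < l := hl₁0.trans_le hl1
  have hli := hmono l ((le_max_left _ _).trans hl1)
  have hri := integrableOn_rpow_mul_exp_neg_Ioi hγ hl0
  set P := (1 / l) ^ g with hP
  have hP0 : 0 < P := by positivity
  have hrn : ∀ u ∈ Ioi (0 : ℝ), ‖((Real.exp (-(l * u)) : ℝ) : ℂ) * (u : ℂ) ^ (γ - 1)‖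
      = u ^ (g - 1) * Real.exp (-(l * u)) := fun u hu => by
    rw [norm_ofReal_exp_mul, hpow u hu, mul_comm]
  have hci : IntegrableOn (fun u : ℝ => ((Real.exp (-(l * u)) : ℝ) : ℂ) * (u : ℂ) ^ (γ - 1)) (Ioi 0) := by
    refine hri.mono' (ContinuousOn.aestronglyMeasurable (ContinuousOn.mul (by fun_prop)
      (fun u hu => (Complex.continuousAt_ofReal_cpow_const u (γ - 1)
        (Or.inr (ne_of_gt hu))).continuousWithinAt)) measurableSet_Ioi) ?_
    filter_upwards [ae_restrict_mem measurableSet_Ioi] with u hu using (hrn u hu).le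
  have hci' : ∫ u : ℝ in Ioi 0, ((Real.exp (-(l * u)) : ℝ) : ℂ) * (u : ℂ) ^ (γ - 1)
      = (1 / (l : ℂ)) ^ γ * Complex.Gamma γ := by
    rw [← Complex.integral_cpow_mul_exp_neg_mul_Ioi hγ hl0]
    refine setIntegral_congr_fun measurableSet_Ioi fun u _ => ?_
    push_cast
    ring
  have hPn : ‖(1 / (l : ℂ)) ^ γ‖ = P := by
    rw [show (1 / (l : ℂ)) = ((1 / l : ℝ) : ℂ) by push_cast; rfl,
      Complex.norm_cpow_eq_rpow_re_of_pos (by positivity)]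
  have hdiff : ∫ u : ℝ in Ioi 0, ‖((Real.exp (-(l * u)) : ℝ) : ℂ) * (κ u - (u : ℂ) ^ (γ - 1))‖
      ≤ P * (‖Complex.Gamma γ‖ / 2) := by
    have h1 : ∫ u : ℝ in Ioi 0, ‖((Real.exp (-(l * u)) : ℝ) : ℂ) * (κ u - (u : ℂ) ^ (γ - 1))‖
        ≤ ∫ u : ℝ in Ioi 0, (ε * (u ^ (g - 1) * Real.exp (-(l * u)))
          + Real.exp (-((l - l₁) * δ)) * R u) := by
      refine setIntegral_mono_on ?_ ((hri.const_mul ε).add (hRi.const_mul _)) measurableSet_Ioi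
        (hpw l hl1)
      simp_rw [mul_sub]
      exact (hli.sub hci).norm
    rw [integral_add (hri.const_mul ε) (hRi.const_mul _), integral_const_mul, integral_const_mul,
      Real.integral_rpow_mul_exp_neg_mul_Ioi hγ hl0] at h1
    have h2 : ε * (P * Real.Gamma g) + ε * (P * Real.Gamma g) = P * (‖Complex.Gamma γ‖ / 2) := by
      rw [hε]; field_simp; ring
    linarith
  have hdi : IntegrableOn (fun u : ℝ => ((Real.exp (-(l * u)) : ℝ) : ℂ) * (κ u - (u : ℂ) ^ (γ - 1)))
      (Ioi 0) := by
    simp_rw [mul_sub]; exact hli.sub hci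
  have hsplit : ∀ u : ℝ, ((Real.exp (-(l * u)) : ℝ) : ℂ) * κ u
      = ((Real.exp (-(l * u)) : ℝ) : ℂ) * (κ u - (u : ℂ) ^ (γ - 1))
        + ((Real.exp (-(l * u)) : ℝ) : ℂ) * (u : ℂ) ^ (γ - 1) := fun u => by ring
  have hlow : P * (‖Complex.Gamma γ‖ / 2) ≤ ‖∫ u : ℝ in Ioi 0, ((Real.exp (-(l * u)) : ℝ) : ℂ) * κ u‖ := by
    have h1 : (∫ u : ℝ in Ioi 0, ((Real.exp (-(l * u)) : ℝ) : ℂ) * κ u)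
        = (∫ u : ℝ in Ioi 0, ((Real.exp (-(l * u)) : ℝ) : ℂ) * (κ u - (u : ℂ) ^ (γ - 1)))
          + (1 / (l : ℂ)) ^ γ * Complex.Gamma γ := by
      rw [← hci', ← integral_add hdi hci]
      simp_rw [← hsplit]
    have h3 := (norm_integral_le_integral_norm (μ := volume.restrict (Ioi (0 : ℝ)))
      (fun u : ℝ => ((Real.exp (-(l * u)) : ℝ) : ℂ) * (κ u - (u : ℂ) ^ (γ - 1)))).trans hdiff
    have h4 := norm_sub_norm_le ((1 / (l : ℂ)) ^ γ * Complex.Gamma γ)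
      (-∫ u : ℝ in Ioi 0, ((Real.exp (-(l * u)) : ℝ) : ℂ) * (κ u - (u : ℂ) ^ (γ - 1)))
    rw [norm_neg, sub_neg_eq_add, norm_mul, hPn, add_comm ((1 / (l : ℂ)) ^ γ * Complex.Gamma γ)] at h4
    rw [h1]
    linarith
  have hup : ∫ u : ℝ in Ioi 0, ‖((Real.exp (-(l * u)) : ℝ) : ℂ) * κ u‖
      ≤ P * (Real.Gamma g + ‖Complex.Gamma γ‖ / 2) := by
    have h1 : ∫ u : ℝ in Ioi 0, ‖((Real.exp (-(l * u)) : ℝ) : ℂ) * κ u‖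
        ≤ ∫ u : ℝ in Ioi 0, (‖((Real.exp (-(l * u)) : ℝ) : ℂ) * (κ u - (u : ℂ) ^ (γ - 1))‖
          + u ^ (g - 1) * Real.exp (-(l * u))) := by
      refine setIntegral_mono_on hli.norm (hdi.norm.add hri) measurableSet_Ioi fun u hu => ?_
      rw [hsplit u, ← hrn u hu]
      exact norm_add_le _ _
    rw [integral_add hdi.norm hri, Real.integral_rpow_mul_exp_neg_mul_Ioi hγ hl0] at h1
    linarith
  calc _ ≤ P * (Real.Gamma g + ‖Complex.Gamma γ‖ / 2) := hup
    _ = (Real.Gamma g + ‖Complex.Gamma γ‖ / 2) / (‖Complex.Gamma γ‖ / 2) *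
        (P * (‖Complex.Gamma γ‖ / 2)) := by field_simp
    _ ≤ _ := by gcongr

/-! ### Integrability of single terms and termwise integration. -/

theorem integrableOn_Ioc_of_tendsto_div_cpow {κ : ℝ → ℂ} (hκ : ContinuousOn κ (Ioi 0)) {γ : ℂ}
    (hγ : 0 < γ.re) (h0 : Tendsto (fun u : ℝ => κ u / (u : ℂ) ^ (γ - 1)) (𝓝[>] 0) (𝓝 1)) {R : ℝ}
    (hR : 0 < R) : IntegrableOn κ (Ioc 0 R) := by
  obtain ⟨δ, hδ, h⟩ := Metric.tendsto_nhdsWithin_nhds.1 h0 1 one_pos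
  set d := min (δ / 2) R with hd
  have hd0 : 0 < d := lt_min (by linarith) hR
  have hdδ : d < δ := (min_le_left _ _).trans_lt (by linarith)
  have hsplit : Ioc 0 R = Ioc 0 d ∪ Ioc d R := (Ioc_union_Ioc_eq_Ioc hd0.le (min_le_right _ _)).symm
  rw [hsplit]
  refine IntegrableOn.union ?_ ?_
  · have hp : IntegrableOn (fun u : ℝ => 2 * u ^ (γ.re - 1)) (Ioc 0 d) :=
      ((intervalIntegrable_iff_integrableOn_Ioc_of_le hd0.le).1
        (intervalIntegral.intervalIntegrable_rpow' (by linarith))).const_mul 2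
    refine hp.mono' ((hκ.mono Ioc_subset_Ioi_self).aestronglyMeasurable measurableSet_Ioc) ?_
    filter_upwards [ae_restrict_mem measurableSet_Ioc] with u hu
    have hpw : ‖(u : ℂ) ^ (γ - 1)‖ = u ^ (γ.re - 1) := by
      rw [Complex.norm_cpow_eq_rpow_re_of_pos hu.1]; simp
    have h1 := (h hu.1 (by simpa [abs_of_pos hu.1] using hu.2.trans_lt hdδ)).le
    rw [dist_eq_norm] at h1
    have h2 : ‖κ u / (u : ℂ) ^ (γ - 1)‖ ≤ 2 := by
      have := norm_sub_norm_le (κ u / (u : ℂ) ^ (γ - 1)) 1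
      rw [norm_one] at this
      linarith
    rwa [norm_div, hpw, div_le_iff₀ (Real.rpow_pos_of_pos hu.1 _)] at h2
  · exact ((hκ.mono (fun u hu => hd0.trans_le hu.1)).integrableOn_Icc).mono_set Ioc_subset_Icc_self

/-- Near infinity the first non-zero term governs the series: its modulus is at least `(‖T n₀‖/2)
e^{-μn₀u}`, so the integrand controls `e^{-μn₀u} κ(u)`. Near the origin `κ` is integrable by itself.
-/
theorem integrableOn_exp_mul_of_integrableOn_mul_tsum {κ : ℝ → ℂ} (hκ : ContinuousOn κ (Ioi 0))
    {γ : ℂ} (hγ : 0 < γ.re) (h0 : Tendsto (fun u : ℝ => κ u / (u : ℂ) ^ (γ - 1)) (𝓝[>] 0) (𝓝 1))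
    {μ : ℝ} (hμ : 0 < μ) {T : ℕ → ℂ}
    (hT : ∀ u : ℝ, 0 < u → Summable fun n : ℕ => T n * ((Real.exp (-(μ * n * u)) : ℝ) : ℂ))
    (hint : IntegrableOn
      (fun u : ℝ => κ u * ∑' n : ℕ, T n * ((Real.exp (-(μ * n * u)) : ℝ) : ℂ)) (Ioi 0))
    {n₀ : ℕ} (hn₀ : T n₀ ≠ 0) (hlt : ∀ n < n₀, T n = 0) :
    IntegrableOn (fun u : ℝ => ((Real.exp (-(μ * n₀ * u)) : ℝ) : ℂ) * κ u) (Ioi 0) := by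
  have hlim : Tendsto (fun u : ℝ => ∑' n : ℕ, T n * ((Real.exp (-(μ * (n - n₀) * u)) : ℝ) : ℂ))
      atTop (𝓝 (T n₀)) := by
    have h : ∑' n, (if n = n₀ then T n₀ else 0) = T n₀ := tsum_ite_eq n₀ _
    rw [← h]
    -- Non-zero terms have `n ≥ n₀`, so they decrease in modulus with `u`, and the summable terms at
    -- `u = 1` dominate for `u ≥ 1`.
    refine tendsto_tsum_of_dominated_convergence
      (bound := fun n => ‖T n * ((Real.exp (-(μ * (n - n₀) * 1)) : ℝ) : ℂ)‖) ?_ (fun n => ?_) ?_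
    · have := ((hT 1 one_pos).mul_left ((Real.exp (μ * n₀) : ℝ) : ℂ)).norm
      refine this.congr fun n => ?_
      rw [mul_left_comm, ← Complex.ofReal_mul, ← Real.exp_add]
      ring_nf
    · rcases lt_trichotomy n n₀ with h | rfl | h
      · simp [hlt n h, h.ne]
      · simp
      · rw [if_neg h.ne']
        have hpos : 0 < μ * ((n : ℝ) - n₀) := mul_pos hμ (sub_pos.2 (by exact_mod_cast h))
        have h1 : Tendsto (fun u : ℝ => Real.exp (-(μ * (n - n₀) * u))) atTop (𝓝 0) :=
          Real.tendsto_exp_neg_atTop_nhds_zero.comp (tendsto_id.const_mul_atTop hpos)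
        have h2 := (Complex.continuous_ofReal.tendsto 0).comp h1
        simpa using h2.const_mul (T n)
    · filter_upwards [eventually_ge_atTop 1] with u hu n
      rcases lt_or_ge n n₀ with h | h
      · simp [hlt n h]
      · have hnn : (0 : ℝ) ≤ (n : ℝ) - n₀ := sub_nonneg.2 (by exact_mod_cast h)
        rw [norm_mul, norm_mul, Complex.norm_real, Complex.norm_real, Real.norm_of_nonneg
          (Real.exp_pos _).le, Real.norm_of_nonneg (Real.exp_pos _).le]
        gcongr
  have hlow : ∀ᶠ u : ℝ in atTop,
      ‖T n₀‖ / 2 ≤ ‖∑' n : ℕ, T n * ((Real.exp (-(μ * (n - n₀) * u)) : ℝ) : ℂ)‖ :=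
    (hlim.norm.eventually_const_le (half_lt_self (norm_pos_iff.2 hn₀)))
  obtain ⟨R, hR⟩ := (hlow.and (eventually_gt_atTop 0)).exists_forall_of_atTop
  have hR0 : 0 < R := (hR R le_rfl).2
  have hmeas : ∀ {s : Set ℝ}, MeasurableSet s → s ⊆ Ioi 0 → AEStronglyMeasurable
      (fun u : ℝ => ((Real.exp (-(μ * n₀ * u)) : ℝ) : ℂ) * κ u) (volume.restrict s) := fun hs hs0 =>
    (((by fun_prop : Continuous fun u : ℝ => ((Real.exp (-(μ * n₀ * u)) : ℝ) : ℂ)).continuousOn.mul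
      hκ).mono hs0).aestronglyMeasurable hs
  rw [← Ioc_union_Ioi_eq_Ioi hR0.le]
  refine IntegrableOn.union ?_ ?_
  · refine (integrableOn_Ioc_of_tendsto_div_cpow hκ hγ h0 hR0).norm.mono'
      (hmeas measurableSet_Ioc Ioc_subset_Ioi_self) ?_
    filter_upwards [ae_restrict_mem measurableSet_Ioc] with u hu
    rw [norm_ofReal_exp_mul]
    refine mul_le_of_le_one_left (norm_nonneg _) (Real.exp_le_one_iff.2 ?_)
    have := hu.1.le
    have : 0 ≤ μ * n₀ * u := by positivity
    linarith
  · have hsub : Ioi R ⊆ Ioi 0 := Ioi_subset_Ioi hR0.le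
    refine ((hint.mono_set hsub).norm.const_mul (2 / ‖T n₀‖)).mono' (hmeas measurableSet_Ioi hsub) ?_
    filter_upwards [ae_restrict_mem measurableSet_Ioi] with u hu
    have h1 := (hR u (le_of_lt hu)).1
    have h2 : ∑' n : ℕ, T n * ((Real.exp (-(μ * n * u)) : ℝ) : ℂ) = ((Real.exp (-(μ * n₀ * u)) : ℝ) : ℂ) *
        ∑' n : ℕ, T n * ((Real.exp (-(μ * (n - n₀) * u)) : ℝ) : ℂ) := by
      rw [← tsum_mul_left]
      congr 1
      ext n
      rw [mul_left_comm, ← Complex.ofReal_mul, ← Real.exp_add]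
      ring_nf
    have h3 := norm_pos_iff.2 hn₀
    rw [norm_ofReal_exp_mul, norm_mul, h2, norm_ofReal_exp_mul]
    calc Real.exp (-(μ * n₀ * u)) * ‖κ u‖
        = 2 / ‖T n₀‖ * (‖κ u‖ * (Real.exp (-(μ * n₀ * u)) * (‖T n₀‖ / 2))) := by field_simp
      _ ≤ _ := by gcongr

/-- Termwise integration of a generalized Dirichlet series against a kernel which behaves like
`u^{γ-1}` at `0`. -/
theorem integral_mul_tsum_exp_eq_tsum {κ : ℝ → ℂ} (hκ : ContinuousOn κ (Ioi 0))
    {γ : ℂ} (hγ : 0 < γ.re) (h0 : Tendsto (fun u : ℝ => κ u / (u : ℂ) ^ (γ - 1)) (𝓝[>] 0) (𝓝 1))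
    {μ : ℝ} (hμ : 0 < μ) {T : ℕ → ℂ}
    (hT : ∀ u : ℝ, 0 < u → Summable fun n : ℕ => T n * ((Real.exp (-(μ * n * u)) : ℝ) : ℂ))
    (hint : IntegrableOn
      (fun u : ℝ => κ u * ∑' n : ℕ, T n * ((Real.exp (-(μ * n * u)) : ℝ) : ℂ)) (Ioi 0))
    {G : ℕ → ℂ}
    (hG : ∀ n : ℕ, IntegrableOn (fun u : ℝ => ((Real.exp (-(μ * n * u)) : ℝ) : ℂ) * κ u) (Ioi 0) →
      ∫ u : ℝ in Ioi 0, ((Real.exp (-(μ * n * u)) : ℝ) : ℂ) * κ u = G n)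
    (hTG : Summable fun n => T n * G n) :
    ∫ u : ℝ in Ioi 0, κ u * ∑' n : ℕ, T n * ((Real.exp (-(μ * n * u)) : ℝ) : ℂ) = ∑' n, T n * G n := by
  classical
  by_cases hex : ∃ n, T n ≠ 0
  swap
  · push Not at hex
    simp [hex]
  set n₀ := Nat.find hex with hn₀def
  have hn₀ : T n₀ ≠ 0 := Nat.find_spec hex
  have hlt : ∀ n < n₀, T n = 0 := fun n hn => not_not.1 (Nat.find_min hex hn)
  have hi₀ := integrableOn_exp_mul_of_integrableOn_mul_tsum hκ hγ h0 hμ hT hint hn₀ hlt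
  have hi : ∀ n : ℕ, n₀ ≤ n →
      IntegrableOn (fun u : ℝ => ((Real.exp (-(μ * n * u)) : ℝ) : ℂ) * κ u) (Ioi 0) := fun n hn => by
    have := integrableOn_exp_mul_of_re_le (s₀ := ((μ * n₀ : ℝ) : ℂ)) (s := ((μ * n : ℝ) : ℂ)) hκ
      (by simpa using hi₀) (by
        rw [Complex.ofReal_re, Complex.ofReal_re]
        gcongr)
    simpa using this
  let F : ℕ → ℝ → ℂ := fun n u => T n * (((Real.exp (-(μ * n * u)) : ℝ) : ℂ) * κ u)
  have hFi : ∀ n, Integrable (F n) (volume.restrict (Ioi 0)) := fun n => by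
    rcases lt_or_ge n n₀ with h | h
    · simp [F, hlt n h]
    · exact (hi n h).const_mul (T n)
  -- Below `n₀` the integral of the kernel may diverge and `hG` says nothing, but there the
  -- coefficient vanishes.
  have hFint : ∀ n, ∫ u in Ioi 0, F n u = T n * G n := fun n => by
    rcases lt_or_ge n n₀ with h | h
    · simp [F, hlt n h]
    · rw [← hG n (hi n h), ← integral_const_mul]
  obtain ⟨C, hC⟩ := exists_integral_norm_le_mul_norm_laplace hκ hγ h0 (l₀ := μ * n₀) hi₀
  -- The lower bound of Watson's type at `l = μn` turns summability of `T n * G n` into summability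
  -- of the `L¹` norms.
  have hev : ∀ᶠ n : ℕ in atTop, ∫ u in Ioi 0, ‖F n u‖ ≤ C * ‖T n * G n‖ := by
    have ht : Tendsto (fun n : ℕ => μ * (n : ℝ)) atTop atTop :=
      tendsto_natCast_atTop_atTop.const_mul_atTop hμ
    filter_upwards [ht.eventually hC, eventually_ge_atTop n₀] with n hn hnn
    simp only [F]
    simp_rw [norm_mul (T n)]
    rw [integral_const_mul, ← hG n (hi n hnn), mul_left_comm]
    gcongr
  have hsum : Summable fun n => ∫ u in Ioi 0, ‖F n u‖ := by
    obtain ⟨N, hN⟩ := eventually_atTop.1 hev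
    rw [← summable_nat_add_iff N]
    refine .of_nonneg_of_le (fun n => integral_nonneg fun u => norm_nonneg _)
      (fun n => hN (n + N) (Nat.le_add_left _ _)) ?_
    exact (summable_nat_add_iff N).2 (hTG.norm.mul_left C)
  have hfin := hasSum_integral_of_summable_integral_norm hFi hsum
  simp_rw [hFint] at hfin
  rw [hfin.tsum_eq]
  refine setIntegral_congr_fun measurableSet_Ioi fun u _ => ?_
  simp only [F]
  rw [← tsum_mul_left]
  congr 1
  ext n
  ring

/-! ### The Saigo–Maeda integral of a power times a generalized Dirichlet series -/

theorem tendsto_oneSubExp_div : Tendsto (fun u : ℝ => oneSubExp u / u) (𝓝[>] 0) (𝓝 1) := by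
  have h : HasDerivAt oneSubExp 1 0 := by
    have := ((hasDerivAt_neg (0 : ℝ)).exp).const_sub 1
    simpa using! this
  refine ((hasDerivAt_iff_tendsto_slope.1 h).mono_left
    (nhdsWithin_mono _ fun u (hu : 0 < u) => hu.ne')).congr fun u => ?_
  simp [slope_def_field, oneSubExp]

/-- As `u → 0` both arguments of `F₃` tend to `0`, where its value is `1`, and `(1 - e^{-u})/u → 1`.
This is the behaviour at `0` that termwise integration requires. -/
theorem tendsto_f3Kernel_div (α α' β β' : ℂ) {γ : ℂ} (hγ : 0 < γ.re) :
    Tendsto (fun u : ℝ => f3Kernel α α' β β' γ u / (u : ℂ) ^ (γ - 1)) (𝓝[>] 0) (𝓝 1) := by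
  have h1 : Tendsto (fun u : ℝ => ((oneSubExp u / u : ℝ) : ℂ) ^ (γ - 1)) (𝓝[>] 0) (𝓝 1) := by
    have hc : ContinuousAt (fun x : ℝ => (x : ℂ) ^ (γ - 1)) 1 :=
      Complex.continuousAt_ofReal_cpow_const 1 (γ - 1) (Or.inr one_ne_zero)
    have := hc.tendsto.comp tendsto_oneSubExp_div
    simpa [Function.comp_def] using this
  have h2 : Tendsto (fun u : ℝ => appellF3 α α' β β' γ (oneSubExp u) ((1 - Real.exp u : ℝ) : ℂ))
      (𝓝[>] 0) (𝓝 1) := by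
    have := (continuousOn_appellF3_exp α α' β β' hγ) 0 self_mem_Ici
    have h3 := this.tendsto.mono_left (nhdsWithin_mono _ Ioi_subset_Ici_self)
    simpa [oneSubExp, appellF3_zero α α' β β' hγ] using h3
  have h12 := h1.mul h2
  rw [mul_one] at h12
  refine h12.congr' ?_
  filter_upwards [self_mem_nhdsWithin] with u hu
  have hu0 : 0 < u := hu
  have e : (oneSubExp u : ℂ) ^ (γ - 1) = ((oneSubExp u / u : ℝ) : ℂ) ^ (γ - 1) * (u : ℂ) ^ (γ - 1) := by
    rw [← Complex.mul_cpow_ofReal_nonneg (div_pos (oneSubExp_pos hu0) hu0).le hu0.le,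
      ← Complex.ofReal_mul, div_mul_cancel₀ _ hu0.ne']
  have hne : (u : ℂ) ^ (γ - 1) ≠ 0 := by
    rw [Ne, Complex.cpow_eq_zero_iff]
    exact fun h => hu0.ne' (by exact_mod_cast h.1)
  rw [f3Kernel, e]
  field_simp

theorem image_mul_exp_Ioi {z : ℝ} (hz : 0 < z) : (fun u => z * Real.exp u) '' Ioi 0 = Ioi z := by
  ext t
  constructor
  · rintro ⟨u, hu, rfl⟩
    have : 1 < Real.exp u := Real.one_lt_exp_iff.2 hu
    simp only [mem_Ioi]
    nlinarith
  · intro ht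
    have ht' : 1 < t / z := (one_lt_div hz).2 ht
    refine ⟨Real.log (t / z), Real.log_pos ht', ?_⟩
    simp only []
    rw [Real.exp_log (by linarith)]
    field_simp

/-- With `t = z e^u` one has `t - z = t(1 - e^{-u})`. The powers of `t`, Jacobian included, combine
to `t^{γ-α+σ-1}`, which is the source of the exponent `1 + α - γ - σ`. -/
theorem saigoMaedaRightIntegrand_mul_exp (α α' β β' γ σ : ℂ) (Φ : ℝ → ℂ) {z : ℝ} (hz : 0 < z)
    {u : ℝ} (hu : 0 < u) :
    |z * Real.exp u| • saigoMaedaRightIntegrand α α' β β' γ (fun t => (t : ℂ) ^ (σ - 1) * Φ t) z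
        (z * Real.exp u)
      = (z : ℂ) ^ (γ - α + σ - 1) *
        (Complex.exp (-((1 + α - γ - σ) * u)) * f3Kernel α α' β β' γ u * Φ (z * Real.exp u)) := by
  have hE := Real.exp_pos u
  have hX := oneSubExp_pos hu
  have ht : 0 < z * Real.exp u := mul_pos hz hE
  have e1 : z * Real.exp u - z = z * Real.exp u * oneSubExp u := by
    have : Real.exp u * Real.exp (-u) = 1 := by rw [← Real.exp_add]; simp
    rw [oneSubExp]
    linear_combination z * this
  have e2 : 1 - z / (z * Real.exp u) = oneSubExp u := by
    rw [oneSubExp, Real.exp_neg]; field_simp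
  have e3 : 1 - z * Real.exp u / z = 1 - Real.exp u := by field_simp
  have e4 : ((z * Real.exp u : ℝ) : ℂ) * (((z * Real.exp u * oneSubExp u : ℝ) : ℂ) ^ (γ - 1) *
      ((z * Real.exp u : ℝ) : ℂ) ^ (-α) * ((z * Real.exp u : ℝ) : ℂ) ^ (σ - 1))
      = (z : ℂ) ^ (γ - α + σ - 1) * (Complex.exp (-((1 + α - γ - σ) * u)) *
        (oneSubExp u : ℂ) ^ (γ - 1)) := by
    have e5 : ((z * Real.exp u : ℝ) : ℂ) * (((z * Real.exp u * oneSubExp u : ℝ) : ℂ) ^ (γ - 1) *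
        ((z * Real.exp u : ℝ) : ℂ) ^ (-α) * ((z * Real.exp u : ℝ) : ℂ) ^ (σ - 1))
        = ((z * Real.exp u : ℝ) : ℂ) ^ (1 : ℂ) * (((z * Real.exp u * oneSubExp u : ℝ) : ℂ) ^ (γ - 1) *
        ((z * Real.exp u : ℝ) : ℂ) ^ (-α) * ((z * Real.exp u : ℝ) : ℂ) ^ (σ - 1)) := by
      rw [Complex.cpow_one]
    rw [e5]
    simp only [ofReal_cpow_eq_exp ht, ofReal_cpow_eq_exp hz, ofReal_cpow_eq_exp hX,
      ofReal_cpow_eq_exp (mul_pos ht hX), Real.log_mul ht.ne' hX.ne', Real.log_mul hz.ne' hE.ne',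
      Real.log_exp, ← Complex.exp_add]
    congr 1
    push_cast
    ring
  rw [saigoMaedaRightIntegrand, abs_of_pos ht, Complex.real_smul, e1, e2, e3, f3Kernel]
  linear_combination (appellF3 α α' β β' γ (oneSubExp u) ((1 - Real.exp u : ℝ) : ℂ) *
    Φ (z * Real.exp u)) * e4

/-- The analytic core, free of the special form of the coefficients. `hp₁`, `hp₂`, `hp₃` keep the
numerator Gammas of `f3Symbol` off their poles; the denominator ones need no such condition, since
`1/Γ` is entire. -/
theorem saigoMaedaRight_cpow_mul_tsum {α α' β β' γ σ : ℂ} {μ z : ℝ} (hγ : 0 < γ.re) (hμ : 0 < μ)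
    (hz : 0 < z) {Φ : ℝ → ℂ} {T : ℕ → ℂ}
    (hT : ∀ u : ℝ, 0 < u → Summable fun n : ℕ => T n * ((Real.exp (-(μ * n * u)) : ℝ) : ℂ))
    (hΦ : ∀ u : ℝ, 0 < u →
      Φ (z * Real.exp u) = ∑' n : ℕ, T n * ((Real.exp (-(μ * n * u)) : ℝ) : ℂ))
    (hint : SaigoMaedaRightExists α α' β β' γ (fun t => (t : ℂ) ^ (σ - 1) * Φ t) z)
    (hp₁ : ∀ n k : ℕ, 1 + α + α' - γ - σ + (μ : ℂ) * n ≠ -(k : ℂ))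
    (hp₂ : ∀ n k : ℕ, 1 + α + β' - γ - σ + (μ : ℂ) * n ≠ -(k : ℂ))
    (hp₃ : ∀ n k : ℕ, 1 - β - σ + (μ : ℂ) * n ≠ -(k : ℂ))
    (hsum : Summable fun n : ℕ => T n * f3Symbol α α' β β' γ (1 + α - γ - σ + μ * n)) :
    saigoMaedaRight α α' β β' γ (fun t => (t : ℂ) ^ (σ - 1) * Φ t) z
      = (z : ℂ) ^ (σ - α - α' + γ - 1) / Complex.Gamma γ *
        ∑' n : ℕ, T n * f3Symbol α α' β β' γ (1 + α - γ - σ + μ * n) := by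
  set s₀ := 1 + α - γ - σ with hs₀
  set κ : ℝ → ℂ := fun u => Complex.exp (-(s₀ * u)) * f3Kernel α α' β β' γ u with hκdef
  have hz' : (z : ℂ) ≠ 0 := by exact_mod_cast hz.ne'
  have hzp : (z : ℂ) ^ (γ - α + σ - 1) ≠ 0 := by
    rw [Ne, Complex.cpow_eq_zero_iff]; exact fun h => hz' h.1
  have hfc := continuousOn_f3Kernel α α' β β' hγ
  have hκ : ContinuousOn κ (Ioi 0) :=
    (by fun_prop : Continuous fun u : ℝ => Complex.exp (-(s₀ * u))).continuousOn.mul hfc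
  have h0 : Tendsto (fun u : ℝ => κ u / (u : ℂ) ^ (γ - 1)) (𝓝[>] 0) (𝓝 1) := by
    have h1 : Tendsto (fun u : ℝ => Complex.exp (-(s₀ * u))) (𝓝[>] 0) (𝓝 1) := by
      have := (by fun_prop : Continuous fun u : ℝ => Complex.exp (-(s₀ * u))).tendsto 0
      simp only [Complex.ofReal_zero, mul_zero, neg_zero, Complex.exp_zero] at this
      exact this.mono_left nhdsWithin_le_nhds
    have h2 := h1.mul (tendsto_f3Kernel_div α α' β β' hγ)
    rw [mul_one] at h2
    exact h2.congr fun u => by simp only [hκdef]; ring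
  have hder : ∀ u ∈ Ioi (0 : ℝ), HasDerivWithinAt (fun u => z * Real.exp u) (z * Real.exp u)
      (Ioi 0) u := fun u _ => ((Real.hasDerivAt_exp u).const_mul z).hasDerivWithinAt
  have hinj : InjOn (fun u => z * Real.exp u) (Ioi 0) := fun u _ v _ h =>
    Real.exp_injective (mul_left_cancel₀ hz.ne' h)
  have hsub : ∀ u ∈ Ioi (0 : ℝ), |z * Real.exp u| • saigoMaedaRightIntegrand α α' β β' γ
      (fun t => (t : ℂ) ^ (σ - 1) * Φ t) z (z * Real.exp u)
      = (z : ℂ) ^ (γ - α + σ - 1) *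
        (κ u * ∑' n : ℕ, T n * ((Real.exp (-(μ * n * u)) : ℝ) : ℂ)) := fun u hu => by
    rw [saigoMaedaRightIntegrand_mul_exp α α' β β' γ σ Φ hz hu, hΦ u hu]
  have hint' : IntegrableOn
      (fun u : ℝ => κ u * ∑' n : ℕ, T n * ((Real.exp (-(μ * n * u)) : ℝ) : ℂ)) (Ioi 0) := by
    have h1 := hint
    rw [SaigoMaedaRightExists, ← image_mul_exp_Ioi hz,
      integrableOn_image_iff_integrableOn_abs_deriv_smul measurableSet_Ioi hder hinj] at h1
    have h2 := (h1.congr_fun hsub measurableSet_Ioi).const_mul ((z : ℂ) ^ (γ - α + σ - 1))⁻¹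
    simpa only [inv_mul_cancel_left₀ hzp] using! h2
  obtain ⟨S, hS⟩ := exists_laplace_f3Kernel α α' β β' hγ
  have hexp : ∀ (n : ℕ) (u : ℝ), ((Real.exp (-(μ * n * u)) : ℝ) : ℂ) * κ u
      = Complex.exp (-((s₀ + μ * n) * u)) * f3Kernel α α' β β' γ u := fun n u => by
    simp only [hκdef]
    rw [← mul_assoc, Complex.ofReal_exp, ← Complex.exp_add]
    push_cast
    ring_nf
  have hG : ∀ n : ℕ, IntegrableOn (fun u : ℝ => ((Real.exp (-(μ * n * u)) : ℝ) : ℂ) * κ u) (Ioi 0) →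
      ∫ u : ℝ in Ioi 0, ((Real.exp (-(μ * n * u)) : ℝ) : ℂ) * κ u
        = f3Symbol α α' β β' γ (s₀ + μ * n) := by
    intro n hi
    simp_rw [hexp] at hi ⊢
    -- Off the poles, being equal to `f3Symbol` amounts to an identity between `L` times an entire
    -- function and an entire function. It is used forwards at the target point and backwards far to
    -- the right.
    have hne₁ : ∀ s : ℂ, (∀ k : ℕ, s + α' ≠ -(k : ℂ)) → (∀ k : ℕ, s + β' ≠ -(k : ℂ)) →
        (∀ k : ℕ, s + γ - α - β ≠ -(k : ℂ)) → ∀ L : ℂ,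
        (L * ((Complex.Gamma (s + α'))⁻¹ * (Complex.Gamma (s + β'))⁻¹ *
          (Complex.Gamma (s + γ - α - β))⁻¹)
        = Complex.Gamma γ * ((Complex.Gamma (s + γ - α))⁻¹ * (Complex.Gamma (s + α' + β'))⁻¹ *
          (Complex.Gamma (s + γ - β))⁻¹)) ↔ L = f3Symbol α α' β β' γ s := by
      intro s k1 k2 k3 L
      have g1 := Complex.Gamma_ne_zero k1
      have g2 := Complex.Gamma_ne_zero k2
      have g3 := Complex.Gamma_ne_zero k3
      have hg : Complex.Gamma (s + α') * Complex.Gamma (s + β') * Complex.Gamma (s + γ - α - β) ≠ 0 :=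
        mul_ne_zero (mul_ne_zero g1 g2) g3
      rw [f3Symbol, ← mul_inv, ← mul_inv, ← mul_inv, ← mul_inv, ← div_eq_mul_inv, ← div_eq_mul_inv,
        div_eq_iff hg, div_mul_eq_mul_div]
    have hd : ∀ f : ℂ → ℂ, Differentiable ℂ f → Differentiable ℂ fun s => (Complex.Gamma (f s))⁻¹ :=
      fun f hf => Complex.differentiable_one_div_Gamma.comp hf
    -- The norms in `S` make the three numerator arguments have positive real part, so the poles are
    -- avoided there as well.
    refine (hne₁ _ (fun k => ?_) (fun k => ?_) (fun k => ?_) _).1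
      (laplace_mul_eq_of_eventually hfc (S := max S (‖α'‖ + ‖β'‖ + ‖γ - α - β‖))
        (D := fun s => (Complex.Gamma (s + α'))⁻¹ * (Complex.Gamma (s + β'))⁻¹ *
          (Complex.Gamma (s + γ - α - β))⁻¹)
        (N := fun s => Complex.Gamma γ * ((Complex.Gamma (s + γ - α))⁻¹ *
          (Complex.Gamma (s + α' + β'))⁻¹ * (Complex.Gamma (s + γ - β))⁻¹))
        (((hd _ (by fun_prop)).mul (hd _ (by fun_prop))).mul (hd _ (by fun_prop)))
        ((((hd _ (by fun_prop)).mul (hd _ (by fun_prop))).mul (hd _ (by fun_prop))).const_mul _)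
        (fun s hs => ?_) hi)
    · rw [show s₀ + (μ : ℂ) * n + α' = 1 + α + α' - γ - σ + (μ : ℂ) * n by rw [hs₀]; ring]
      exact hp₁ n k
    · rw [show s₀ + (μ : ℂ) * n + β' = 1 + α + β' - γ - σ + (μ : ℂ) * n by rw [hs₀]; ring]
      exact hp₂ n k
    · rw [show s₀ + (μ : ℂ) * n + γ - α - β = 1 - β - σ + (μ : ℂ) * n by rw [hs₀]; ring]
      exact hp₃ n k
    · rw [max_lt_iff] at hs
      have b1 := (abs_le.1 (Complex.abs_re_le_norm α')).1
      have b2 := (abs_le.1 (Complex.abs_re_le_norm β')).1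
      have b3 := (abs_le.1 (Complex.abs_re_le_norm (γ - α - β))).1
      simp only [Complex.sub_re] at b3
      have n1 := norm_nonneg α'
      have n2 := norm_nonneg β'
      have n3 := norm_nonneg (γ - α - β)
      exact (hne₁ s (ne_neg_natCast_of_re_pos (by simp; linarith))
        (ne_neg_natCast_of_re_pos (by simp; linarith))
        (ne_neg_natCast_of_re_pos (by simp; linarith)) _).2 (hS s hs.1).2
  have hmain := integral_mul_tsum_exp_eq_tsum hκ hγ h0 hμ hT hint' hG hsum
  rw [saigoMaedaRight, ← image_mul_exp_Ioi hz,
    integral_image_eq_integral_abs_deriv_smul measurableSet_Ioi hder hinj,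
    setIntegral_congr_fun measurableSet_Ioi hsub, integral_const_mul, hmain,
    show σ - α - α' + γ - 1 = -α' + (γ - α + σ - 1) by ring, Complex.cpow_add _ _ hz']
  ring

/-! ### The image formulas -/

theorem rpow_neg_mul_exp_pow {z : ℝ} (hz : 0 < z) (c μ u : ℝ) (n : ℕ) :
    (((c * (z * Real.exp u) ^ (-μ) : ℝ) : ℂ)) ^ n
      = ((c * z ^ (-μ) : ℝ) : ℂ) ^ n * ((Real.exp (-(μ * n * u)) : ℝ) : ℂ) := by
  rw [← Complex.ofReal_pow, ← Complex.ofReal_pow, ← Complex.ofReal_mul,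
    Real.mul_rpow hz.le (Real.exp_pos u).le, ← Real.exp_mul, ← mul_assoc, mul_pow _ (Real.exp _),
    ← Real.exp_nat_mul]
  ring_nf

theorem prod_Gamma_add_natCast {p : ℕ} {a : Fin p → ℂ} (ha : ∀ i (k : ℕ), a i ≠ -(k : ℂ)) (n : ℕ) :
    ∏ i, Complex.Gamma (a i + n) = (∏ i, poch (a i) n) * gammaProd a := by
  rw [gammaProd, ← Finset.prod_mul_distrib]
  exact Finset.prod_congr rfl fun i _ => (poch_mul_Gamma (ha i) n).symm

theorem gammaProd_ne_zero {p : ℕ} {a : Fin p → ℂ} (ha : ∀ i (k : ℕ), a i ≠ -(k : ℂ)) :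
    gammaProd a ≠ 0 :=
  Finset.prod_ne_zero_iff.2 fun i _ => Complex.Gamma_ne_zero (ha i)

/-- The terms of the K-function times the Laplace transform of the kernel are Fox–Wright terms. -/
theorem foxWrightTerm_append {p q : ℕ} {a : Fin p → ℂ} {b : Fin q → ℂ}
    (ha : ∀ i (k : ℕ), a i ≠ -(k : ℂ)) (hb : ∀ j (k : ℕ), b j ≠ -(k : ℂ))
    (α α' β β' γ η ν ξ σ w : ℂ) (μ : ℝ) (hν : ∀ k : ℕ, ν ≠ -(k : ℂ)) (n : ℕ) :
    kFunctionTerm a b ξ η ν w n * f3Symbol α α' β β' γ (1 + α - γ - σ + μ * n)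
      = Complex.Gamma γ * (gammaProd b / gammaProd a / Complex.Gamma ν) * foxWrightTerm
          (Fin.append (fun i => (a i, (1 : ℂ)))
            ![(1 + α + α' - γ - σ, (μ : ℂ)), (1 + α + β' - γ - σ, (μ : ℂ)),
              (1 - β - σ, (μ : ℂ)), (ν, (1 : ℂ))])
          (Fin.append (fun j => (b j, (1 : ℂ)))
            ![(1 - σ, (μ : ℂ)), (1 + α + α' + β' - γ - σ, (μ : ℂ)),
              (1 + α - β - σ, (μ : ℂ)), (η, ξ)]) w n := by
  have hga := gammaProd_ne_zero ha
  have hgb := gammaProd_ne_zero hb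
  have hgν := Complex.Gamma_ne_zero hν
  rw [kFunctionTerm, foxWrightTerm, Fin.prod_univ_add, Fin.prod_univ_add]
  simp only [Fin.append_left, Fin.append_right, Fin.prod_univ_four, one_mul,
    prod_Gamma_add_natCast ha, prod_Gamma_add_natCast hb]
  simp only [Matrix.cons_val_zero, Matrix.cons_val_one, Matrix.cons_val, one_mul]
  rw [← poch_mul_Gamma hν, f3Symbol,
    show 1 + α - γ - σ + (μ : ℂ) * n + α' = 1 + α + α' - γ - σ + μ * n by ring,
    show 1 + α - γ - σ + (μ : ℂ) * n + β' = 1 + α + β' - γ - σ + μ * n by ring,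
    show 1 + α - γ - σ + (μ : ℂ) * n + γ - α - β = 1 - β - σ + μ * n by ring,
    show 1 + α - γ - σ + (μ : ℂ) * n + γ - α = 1 - σ + μ * n by ring,
    show 1 + α + α' - γ - σ + (μ : ℂ) * n + β' = 1 + α + α' + β' - γ - σ + μ * n by ring,
    show 1 + α - γ - σ + (μ : ℂ) * n + γ - β = 1 + α - β - σ + μ * n by ring,
    add_comm (ξ * (n : ℂ)) η]
  -- The denominator Gammas of the symbol and of `η + ξn` may be at poles, where both sides vanish,
  -- so their inverses are kept as opaque factors. Only the Gammas of `a`, `b` and `ν` are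
  -- cancelled.
  simp only [div_eq_mul_inv, mul_inv]
  generalize (∏ j, poch (b j) n)⁻¹ = pb
  generalize (∏ i, poch (a i) n) = pa
  have h1 : gammaProd a * (gammaProd a)⁻¹ = 1 := mul_inv_cancel₀ hga
  have h2 : gammaProd b * (gammaProd b)⁻¹ = 1 := mul_inv_cancel₀ hgb
  have h3 : Complex.Gamma ν * (Complex.Gamma ν)⁻¹ = 1 := mul_inv_cancel₀ hgν
  generalize (gammaProd a)⁻¹ = ia at *
  generalize (gammaProd b)⁻¹ = ib at *
  generalize (Complex.Gamma ν)⁻¹ = iv at *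
  generalize (Complex.Gamma (1 - σ + μ * n))⁻¹ * (Complex.Gamma (1 + α + α' + β' - γ - σ + μ * n))⁻¹ *
    (Complex.Gamma (1 + α - β - σ + μ * n))⁻¹ = D
  generalize Complex.Gamma (1 + α + α' - γ - σ + μ * n) *
    Complex.Gamma (1 + α + β' - γ - σ + μ * n) * Complex.Gamma (1 - β - σ + μ * n) = N
  generalize w ^ n * (n.factorial : ℂ)⁻¹ = W
  generalize (Complex.Gamma (η + ξ * n))⁻¹ = V
  linear_combination (-(pa * pb * (poch ν n * V) * W * (Complex.Gamma γ * N * D))) *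
    (gammaProd b * ib * (Complex.Gamma ν * iv) * h1 + Complex.Gamma ν * iv * h2 + h3)

/-- The right-sided Saigo–Maeda integral of the K-function. -/
theorem saigoMaedaRight_kFunction {p q : ℕ} (a : Fin p → ℂ) (b : Fin q → ℂ)
    (α α' β β' γ η ν ξ σ : ℂ) (μ c z : ℝ)
    (hν : 0 < ν.re) (hγ : 0 < γ.re) (hμ : 0 < μ) (hz : 0 < z)
    (hK : ∀ t : ℝ, z < t → KFunctionExists a b ξ η ν ((c * t ^ (-μ) : ℝ) : ℂ))
    (hint : SaigoMaedaRightExists α α' β β' γ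
      (fun t => (t : ℂ) ^ (σ - 1) * kFunction a b ξ η ν ((c * t ^ (-μ) : ℝ) : ℂ)) z)
    (hfw : FoxWrightExists
      (Fin.append (fun i => (a i, (1 : ℂ)))
        ![(1 + α + α' - γ - σ, (μ : ℂ)), (1 + α + β' - γ - σ, (μ : ℂ)),
          (1 - β - σ, (μ : ℂ)), (ν, (1 : ℂ))])
      (Fin.append (fun j => (b j, (1 : ℂ)))
        ![(1 - σ, (μ : ℂ)), (1 + α + α' + β' - γ - σ, (μ : ℂ)),
          (1 + α - β - σ, (μ : ℂ)), (η, ξ)])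
      ((c * z ^ (-μ) : ℝ) : ℂ)) :
    saigoMaedaRight α α' β β' γ
        (fun t => (t : ℂ) ^ (σ - 1) * kFunction a b ξ η ν ((c * t ^ (-μ) : ℝ) : ℂ)) z =
      gammaProd b / gammaProd a *
        ((z : ℂ) ^ (σ - α - α' + γ - 1) / Complex.Gamma ν) *
        foxWright
          (Fin.append (fun i => (a i, (1 : ℂ)))
            ![(1 + α + α' - γ - σ, (μ : ℂ)), (1 + α + β' - γ - σ, (μ : ℂ)),
              (1 - β - σ, (μ : ℂ)), (ν, (1 : ℂ))])
          (Fin.append (fun j => (b j, (1 : ℂ)))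
            ![(1 - σ, (μ : ℂ)), (1 + α + α' + β' - γ - σ, (μ : ℂ)),
              (1 + α - β - σ, (μ : ℂ)), (η, ξ)])
          ((c * z ^ (-μ) : ℝ) : ℂ) := by
  obtain ⟨hpole, hsum⟩ := hfw
  have hb := (hK (z + 1) (by linarith)).1
  -- The index `n = 0` of the Fox–Wright pole condition says that no `a i` is a pole of `Γ`.
  have ha : ∀ i (k : ℕ), a i ≠ -(k : ℂ) := fun i k => by
    have := hpole (Fin.castAdd 4 i) 0 k
    simpa only [Fin.append_left, Nat.cast_zero, mul_zero, add_zero] using this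
  have hp₁ := hpole (Fin.natAdd p 0)
  have hp₂ := hpole (Fin.natAdd p 1)
  have hp₃ := hpole (Fin.natAdd p 2)
  simp only [Fin.append_right, Matrix.cons_val_zero, Matrix.cons_val_one, Matrix.cons_val]
    at hp₁ hp₂ hp₃
  have hterm : ∀ (u : ℝ) (n : ℕ), kFunctionTerm a b ξ η ν ((c * (z * Real.exp u) ^ (-μ) : ℝ) : ℂ) n
      = kFunctionTerm a b ξ η ν ((c * z ^ (-μ) : ℝ) : ℂ) n * ((Real.exp (-(μ * n * u)) : ℝ) : ℂ) :=
    fun u n => by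
      rw [kFunctionTerm, kFunctionTerm, rpow_neg_mul_exp_pow hz]
      ring
  have hgt : ∀ u : ℝ, 0 < u → z < z * Real.exp u := fun u hu => by
    have : 1 < Real.exp u := Real.one_lt_exp_iff.2 hu
    nlinarith
  have hfox := fun n => foxWrightTerm_append ha hb α α' β β' γ η ν ξ σ ((c * z ^ (-μ) : ℝ) : ℂ) μ
    (ne_neg_natCast_of_re_pos hν) n
  -- `T` consists of the terms at `t = z`. Their own series need not converge; convergence is used
  -- only after the damping `e^{-μnu}`, that is, at `t = z e^u > z`.
  rw [saigoMaedaRight_cpow_mul_tsum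
    (Φ := fun t => kFunction a b ξ η ν ((c * t ^ (-μ) : ℝ) : ℂ))
    (T := kFunctionTerm a b ξ η ν ((c * z ^ (-μ) : ℝ) : ℂ)) hγ hμ hz
    (fun u hu => ((hK _ (hgt u hu)).2).congr (hterm u))
    (fun u hu => tsum_congr (hterm u)) hint hp₁ hp₂ hp₃
    ((hsum.mul_left _).congr fun n => (hfox n).symm)]
  have hΓ := Complex.Gamma_ne_zero_of_re_pos hγ
  rw [tsum_congr hfox, tsum_mul_left, foxWright]
  field_simp

theorem poch_one (n : ℕ) : poch 1 n = n.factorial := by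
  rw [poch, ascPochhammer_eval_one]

/-- The M-series is the K-function with `ν = 1`. -/
theorem kFunctionTerm_one {p q : ℕ} (a : Fin p → ℂ) (b : Fin q → ℂ) (ξ η w : ℂ) :
    kFunctionTerm a b ξ η 1 w = mSeriesTerm a b ξ η w := by
  ext n
  have : (n.factorial : ℂ) ≠ 0 := by exact_mod_cast n.factorial_ne_zero
  rw [kFunctionTerm, mSeriesTerm, poch_one, mul_assoc, div_mul_div_comm, mul_comm (n.factorial : ℂ),
    mul_div_mul_right _ _ this]

theorem kFunction_one {p q : ℕ} (a : Fin p → ℂ) (b : Fin q → ℂ) (ξ η w : ℂ) :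
    kFunction a b ξ η 1 w = mSeries a b ξ η w := by
  rw [kFunction, mSeries, kFunctionTerm_one]

end

theorem mainTheorem7 {p q : ℕ} (a : Fin p → ℂ) (b : Fin q → ℂ)
    (α α' β β' γ η ν ξ σ : ℂ) (μ c z : ℝ)
    (hν : 0 < ν.re) (hξ : 0 < ξ.re) (hγ : 0 < γ.re) (hμ : 0 < μ) (hz : 0 < z) :
    -- the formula for the M-series, provided that both members exist
    ((∀ t : ℝ, z < t → MSeriesExists a b ξ η ((c * t ^ (-μ) : ℝ) : ℂ)) →
      SaigoMaedaRightExists α α' β β' γ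
        (fun t => (t : ℂ) ^ (σ - 1) * mSeries a b ξ η ((c * t ^ (-μ) : ℝ) : ℂ)) z →
      FoxWrightExists
        (Fin.append (fun i => (a i, (1 : ℂ)))
          ![(1 + α + α' - γ - σ, (μ : ℂ)), (1 + α + β' - γ - σ, (μ : ℂ)),
            (1 - β - σ, (μ : ℂ)), ((1 : ℂ), (1 : ℂ))])
        (Fin.append (fun j => (b j, (1 : ℂ)))
          ![(1 - σ, (μ : ℂ)), (1 + α + α' + β' - γ - σ, (μ : ℂ)),
            (1 + α - β - σ, (μ : ℂ)), (η, ξ)])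
        ((c * z ^ (-μ) : ℝ) : ℂ) →
      saigoMaedaRight α α' β β' γ
          (fun t => (t : ℂ) ^ (σ - 1) * mSeries a b ξ η ((c * t ^ (-μ) : ℝ) : ℂ)) z =
        gammaProd b / gammaProd a * (z : ℂ) ^ (σ - α - α' + γ - 1) *
          foxWright
            (Fin.append (fun i => (a i, (1 : ℂ)))
              ![(1 + α + α' - γ - σ, (μ : ℂ)), (1 + α + β' - γ - σ, (μ : ℂ)),
                (1 - β - σ, (μ : ℂ)), ((1 : ℂ), (1 : ℂ))])
            (Fin.append (fun j => (b j, (1 : ℂ)))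
              ![(1 - σ, (μ : ℂ)), (1 + α + α' + β' - γ - σ, (μ : ℂ)),
                (1 + α - β - σ, (μ : ℂ)), (η, ξ)])
            ((c * z ^ (-μ) : ℝ) : ℂ)) ∧
    -- the formula for the K-function, provided that both members exist
    ((∀ t : ℝ, z < t → KFunctionExists a b ξ η ν ((c * t ^ (-μ) : ℝ) : ℂ)) →
      SaigoMaedaRightExists α α' β β' γ
        (fun t => (t : ℂ) ^ (σ - 1) * kFunction a b ξ η ν ((c * t ^ (-μ) : ℝ) : ℂ)) z →
      FoxWrightExists
        (Fin.append (fun i => (a i, (1 : ℂ)))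
          ![(1 + α + α' - γ - σ, (μ : ℂ)), (1 + α + β' - γ - σ, (μ : ℂ)),
            (1 - β - σ, (μ : ℂ)), (ν, (1 : ℂ))])
        (Fin.append (fun j => (b j, (1 : ℂ)))
          ![(1 - σ, (μ : ℂ)), (1 + α + α' + β' - γ - σ, (μ : ℂ)),
            (1 + α - β - σ, (μ : ℂ)), (η, ξ)])
        ((c * z ^ (-μ) : ℝ) : ℂ) →
      saigoMaedaRight α α' β β' γ
          (fun t => (t : ℂ) ^ (σ - 1) * kFunction a b ξ η ν ((c * t ^ (-μ) : ℝ) : ℂ)) z =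
        gammaProd b / gammaProd a *
          ((z : ℂ) ^ (σ - α - α' + γ - 1) / Complex.Gamma ν) *
          foxWright
            (Fin.append (fun i => (a i, (1 : ℂ)))
              ![(1 + α + α' - γ - σ, (μ : ℂ)), (1 + α + β' - γ - σ, (μ : ℂ)),
                (1 - β - σ, (μ : ℂ)), (ν, (1 : ℂ))])
            (Fin.append (fun j => (b j, (1 : ℂ)))
              ![(1 - σ, (μ : ℂ)), (1 + α + α' + β' - γ - σ, (μ : ℂ)),
                (1 + α - β - σ, (μ : ℂ)), (η, ξ)])
            ((c * z ^ (-μ) : ℝ) : ℂ)) := by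
  refine ⟨fun hM hint hfw => ?_, fun hK hint hfw => saigoMaedaRight_kFunction a b α α' β β' γ η ν ξ σ
    μ c z hν hγ hμ hz hK hint hfw⟩
  -- At `ν = 1` the K-function is the M-series, the parameter `(ν, 1)` is `(1, 1)`, and `Γ(ν) = 1`.
  have h := saigoMaedaRight_kFunction a b α α' β β' γ η 1 ξ σ μ c z (by simp) hγ hμ hz
    (fun t ht => by rw [KFunctionExists, kFunctionTerm_one]; exact hM t ht)
    (by simpa only [kFunction_one] using hint) hfw
  simpa only [kFunction_one, Complex.Gamma_one, div_one] using h
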